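/- Assume Jensen's $\Diamond$-principle: there are sets $D_\alpha\subseteq\alpha$, for $\alpha<\omega_1$ limit, such that for every $S\subseteq\omega_1$ the set $\{\alpha<\omega_1 \text{ limit} : S\cap\alpha=D_\alpha\}$ is stationary in $\omega_1$. Then $\mathrm{FCA}(part)$ holds: for every good type $\tau=\langle m_k,n_{k+1},r_{k+1}\rangle_{k\in\omega}$ and every partition $\mathcal P$ of $\omega$ compatible with $\tau$, there is a $\mathcal P$-fully capturing construction scheme over $\omega_1$ of type $\tau$. The notions are as follows; $\mathrm{FIN}(X)$ is the set of nonempty finite subsets of $X$, $A\sqsubseteq B$ means that $A$ is an initial segment of $B$, and $A<B$ means that $B\neq\emptyset$ and $a<b$ for all $a\in A$, $b\in B$. A type is a sequence of triples of natural numbers such that $m_0=1$ and, for all $k\in\omega$, $n_{k+1}\ge 2$, $m_k>r_{k+1}$ and $m_{k+1}=r_{k+1}+(m_k-r_{k+1})n_{k+1}$. It is good if for each $r\in\omega$ there are infinitely many $k$ with $r_k=r$; a partition $\mathcal P$ of $\omega$ is compatible with it if for each $P\in\mathcal P$ and $r\in\omega$ there are infinitely many $k\in P$ with $r_k=r$.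 A construction scheme over a set of ordinals $X$ of type $\tau$ is a family $\mathcal F\subseteq \mathrm{FIN}(X)$ which, with $\mathcal F_k$ denoting the set of elements of rank $k$ of the well-founded order $(\mathcal F,\subseteq)$, satisfies: (a) every $A\in\mathrm{FIN}(X)$ is contained in some $F\in\mathcal F$; (b) $|F|=m_k$ for all $F\in\mathcal F_k$; (c) $E\cap F\sqsubseteq E$ and $E\cap F\sqsubseteq F$ for all $E,F\in\mathcal F_k$; (d) each $F\in\mathcal F_{k+1}$ is the union of some $F_0,\dots,F_{n_{k+1}-1}\in\mathcal F_k$ which form a $\Delta$-system with a root $R(F)$ such that $|R(F)|=r_{k+1}$ and $R(F)<F_0\setminus R(F)<\dots<F_{n_{k+1}-1}\setminus R(F)$ (these are uniquely determined by $F$). For such $\mathcal F$ let $\rho(\alpha,\beta)=\min\{k:\exists F\in\mathcal F_k\ \{\alpha,\beta\}\subseteq F\}$ and, for $A\in \mathrm{FIN}(X)$, $\rho^A=\max\{\rho(\alpha,\beta):\alpha,\beta\in A\}$ and $(A)_k=\{\alpha\in X:\exists\beta\in A\ (\alpha\le\beta,\ \rho(\alpha,\beta)\le k)\}$. For $l>\rho^A$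 and any $F\in\mathcal F_l$ with $A\subseteq F$, let $\Xi_A(l)=-1$ if $A\subseteq R(F)$, and $\Xi_A(l)=i$ if $A\not\subseteq R(F)$ and $A\subseteq F_i$ (this does not depend on $F$). Sets $A,B\in\mathrm{FIN}(X)$ with $\rho^A,\rho^B<l:=\rho^{A\cup B}$ are strongly $\rho$-isomorphic if $|(A)_{l-1}|=|(B)_{l-1}|$ and the increasing bijection $h:(A)_{l-1}\to(B)_{l-1}$ satisfies $h[A]=B$. A finite $\mathcal D\subseteq\mathrm{FIN}(X)$ is captured at level $l$ if $2\le|\mathcal D|\le n_l$; $l=\rho^{\bigcup\mathcal D}>\rho^D$ for each $D\in\mathcal D$; $\{\Xi_D(l):D\in\mathcal D\}=\{0,\dots,|\mathcal D|-1\}$; and any two distinct members of $\mathcal D$ are strongly $\rho$-isomorphic. It is fully captured at level $l$ if moreover $|\mathcal D|=n_l$. Finally, $\mathcal F$ is $\mathcal P$-fully capturing if for each uncountable $\mathcal S\subseteq\mathrm{FIN}(X)$ and each $P\in\mathcal P$ there are infinitely many $l\in P$ for which some finite $\mathcal D\subseteq\mathcal S$ is fully captured at level $l$. -/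

import Mathlib

open Ordinal

namespace ConstructionScheme

/-- A type `⟨m_k, n_{k+1}, r_{k+1}⟩`. The values `n 0` and `r 0` carry no meaning and
play no role anywhere. -/
structure SchemeType where
  m : ℕ → ℕ
  n : ℕ → ℕ
  r : ℕ → ℕ
  m_zero : m 0 = 1
  two_le_n : ∀ k, 2 ≤ n (k + 1)
  r_lt_m : ∀ k, r (k + 1) < m k
  m_succ : ∀ k, m (k + 1) = r (k + 1) + (m k - r (k + 1)) * n (k + 1)

/-- A type is good if every natural number occurs infinitely often among the `r_k`. -/
def SchemeType.IsGood (τ : SchemeType) : Prop :=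
  ∀ c : ℕ, {k | τ.r k = c}.Infinite

/-- A family `𝒬` of sets of natural numbers is compatible with `τ` if every natural number
occurs infinitely often among the `r_k` with `k ∈ P`, for each `P ∈ 𝒬`. -/
def SchemeType.Compatible (τ : SchemeType) (𝒬 : Set (Set ℕ)) : Prop :=
  ∀ P ∈ 𝒬, ∀ c : ℕ, {k | k ∈ P ∧ τ.r k = c}.Infinite

/-- The set `FIN(X)` of nonempty finite subsets of `X`. -/
def FIN (X : Set Ordinal.{0}) : Set (Finset Ordinal.{0}) :=
  {A | A.Nonempty ∧ (A : Set Ordinal.{0}) ⊆ X}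

/-- `A ⊑ B`: `A` is an initial segment of `B`. -/
def InitSeg (A B : Finset Ordinal.{0}) : Prop :=
  A ⊆ B ∧ ∀ x ∈ A, ∀ y ∈ B, y < x → y ∈ A

/-- `A < B`: `B` is nonempty and every element of `A` is below every element of `B`. -/
def Below (A B : Finset Ordinal.{0}) : Prop :=
  B.Nonempty ∧ ∀ a ∈ A, ∀ b ∈ B, a < b

/-- `ℱ_k`: the members of `ℱ` of rank `k` in the well-founded order `(ℱ, ⊂)`. -/
def level (ℱ : Set (Finset Ordinal.{0})) (k : ℕ) : Set (Finset Ordinal.{0}) :=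
  {F | ∃ h : F ∈ ℱ, IsWellFounded.rank (α := ℱ) (· < ·) ⟨F, h⟩ = (k : Ordinal)}

/-- `F` is the union of `P 0, …, P (n_{k+1} - 1) ∈ ℱ_k`, which form a `Δ`-system with root `R`
of size `r_{k+1}` and `R < P 0 \ R < ⋯ < P (n_{k+1} - 1) \ R`.
(The values `P i` for `i ≥ n_{k+1}` are irrelevant.) -/
structure IsDecomposition (τ : SchemeType) (ℱ : Set (Finset Ordinal.{0})) (k : ℕ)
    (F : Finset Ordinal.{0}) (P : ℕ → Finset Ordinal.{0}) (R : Finset Ordinal.{0}) : Prop where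
  mem_level : ∀ i < τ.n (k + 1), P i ∈ level ℱ k
  union_eq : F = (Finset.range (τ.n (k + 1))).biUnion P
  inter_eq : ∀ i < τ.n (k + 1), ∀ j < τ.n (k + 1), i ≠ j → P i ∩ P j = R
  card_root : R.card = τ.r (k + 1)
  root_below : ∀ i < τ.n (k + 1), Below R (P i \ R)
  tails_below : ∀ i j, i < j → j < τ.n (k + 1) → Below (P i \ R) (P j \ R)

/-- `ℱ` is a construction scheme over the set of ordinals `X` of type `τ`. -/
structure IsConstructionScheme (τ : SchemeType) (X : Set Ordinal.{0})
    (ℱ : Set (Finset Ordinal.{0})) : Prop where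
  subset_FIN : ℱ ⊆ FIN X
  cofinal : ∀ A ∈ FIN X, ∃ F ∈ ℱ, A ⊆ F
  card_eq : ∀ k, ∀ F ∈ level ℱ k, F.card = τ.m k
  initSeg : ∀ k, ∀ E ∈ level ℱ k, ∀ F ∈ level ℱ k, InitSeg (E ∩ F) E ∧ InitSeg (E ∩ F) F
  decomposition : ∀ k, ∀ F ∈ level ℱ (k + 1), ∃ P R, IsDecomposition τ ℱ k F P R

/-- The ordinal metric `ρ_ℱ`: the least `k` such that some member of `ℱ_k` contains
`α` and `β`. -/
noncomputable def rho (ℱ : Set (Finset Ordinal.{0})) (α β : Ordinal.{0}) : ℕ :=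
  sInf {k | ∃ F ∈ level ℱ k, α ∈ F ∧ β ∈ F}

/-- The diameter `ρ^A = max {ρ(α, β) : α, β ∈ A}`. -/
noncomputable def diam (ℱ : Set (Finset Ordinal.{0})) (A : Finset Ordinal.{0}) : ℕ :=
  (A ×ˢ A).sup fun p => rho ℱ p.1 p.2

/-- The `k`-closure `(A)_k = {α ∈ X : ∃ β ∈ A, α ≤ β and ρ(α, β) ≤ k}`. -/
def closure (X : Set Ordinal.{0}) (ℱ : Set (Finset Ordinal.{0})) (A : Finset Ordinal.{0})
    (k : ℕ) : Set Ordinal.{0} :=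
  {α | α ∈ X ∧ ∃ β ∈ A, α ≤ β ∧ rho ℱ α β ≤ k}

/-- `Ξ_A(l) = i`, for `l > ρ^A`: for a set `F ∈ ℱ_l` with `A ⊆ F`, either `A` is contained in the
root of `F` and `i = -1`, or `A` is not contained in the root and `A` is contained in the
`i`-th piece of `F`. -/
def XiEq (τ : SchemeType) (ℱ : Set (Finset Ordinal.{0})) (A : Finset Ordinal.{0}) (l : ℕ)
    (i : ℤ) : Prop :=
  ∃ k, l = k + 1 ∧ ∃ F ∈ level ℱ l, A ⊆ F ∧ ∃ P R, IsDecomposition τ ℱ k F P R ∧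
    ((A ⊆ R ∧ i = -1) ∨ (¬ A ⊆ R ∧ ∃ j < τ.n l, A ⊆ P j ∧ i = (j : ℤ)))

/-- `A` and `B` are strongly `ρ`-isomorphic: with `l = ρ^{A ∪ B} > ρ^A, ρ^B`, there is an
increasing bijection `h` from `(A)_{l-1}` onto `(B)_{l-1}` (necessarily unique), and `h[A] = B`. -/
def StronglyIsomorphic (X : Set Ordinal.{0}) (ℱ : Set (Finset Ordinal.{0}))
    (A B : Finset Ordinal.{0}) : Prop :=
  diam ℱ A < diam ℱ (A ∪ B) ∧ diam ℱ B < diam ℱ (A ∪ B) ∧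
    ∃ h : closure X ℱ A (diam ℱ (A ∪ B) - 1) ≃o closure X ℱ B (diam ℱ (A ∪ B) - 1),
      (fun x => (h x : Ordinal.{0})) '' {x | (x : Ordinal.{0}) ∈ A} = (B : Set Ordinal.{0})

/-- The finite family `𝒟` (of members of `FIN X`) is captured at level `l`. -/
structure IsCaptured (τ : SchemeType) (X : Set Ordinal.{0}) (ℱ : Set (Finset Ordinal.{0}))
    (𝒟 : Finset (Finset Ordinal.{0})) (l : ℕ) : Prop where
  two_le_card : 2 ≤ 𝒟.card
  card_le : 𝒟.card ≤ τ.n l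
  diam_union : diam ℱ (𝒟.biUnion id) = l
  diam_lt : ∀ D ∈ 𝒟, diam ℱ D < l
  xi_eq : {i : ℤ | ∃ D ∈ 𝒟, XiEq τ ℱ D l i} = {i : ℤ | 0 ≤ i ∧ i < 𝒟.card}
  stronglyIsomorphic : ∀ D ∈ 𝒟, ∀ E ∈ 𝒟, D ≠ E → StronglyIsomorphic X ℱ D E

/-- The finite family `𝒟` is fully captured at level `l`. -/
def IsFullyCaptured (τ : SchemeType) (X : Set Ordinal.{0}) (ℱ : Set (Finset Ordinal.{0}))
    (𝒟 : Finset (Finset Ordinal.{0})) (l : ℕ) : Prop :=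
  IsCaptured τ X ℱ 𝒟 l ∧ 𝒟.card = τ.n l

/-- `ℱ` is `𝒬`-fully capturing. -/
def IsFullyCapturing (τ : SchemeType) (X : Set Ordinal.{0}) (ℱ : Set (Finset Ordinal.{0}))
    (𝒬 : Set (Set ℕ)) : Prop :=
  ∀ 𝒮 : Set (Finset Ordinal.{0}), 𝒮 ⊆ FIN X → ¬ 𝒮.Countable → ∀ P ∈ 𝒬,
    {l | l ∈ P ∧ ∃ 𝒟 : Finset (Finset Ordinal.{0}),
      (𝒟 : Set (Finset Ordinal.{0})) ⊆ 𝒮 ∧ IsFullyCaptured τ X ℱ 𝒟 l}.Infinite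

/-- `D` is a `◇`-sequence over `ω₁`, indexed by the countable limit ordinals (other values of
`D` are irrelevant): `D α ⊆ α`, and for each `S ⊆ ω₁` the set of limit `α < ω₁` with
`S ∩ α = D α` is stationary in `ω₁`. -/
def IsDiamondSequence (D : Ordinal.{0} → Set Ordinal.{0}) : Prop :=
  (∀ α < ω₁, Order.IsSuccLimit α → D α ⊆ Set.Iio α) ∧
  ∀ S : Set Ordinal.{0}, S ⊆ Set.Iio ω₁ →
    IsStationary {α : Set.Iio (ω₁ : Ordinal.{0}) |
      Order.IsSuccLimit (α : Ordinal.{0}) ∧ S ∩ Set.Iio (α : Ordinal.{0}) = D α}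

/-- Jensen's `◇`-principle. -/
def DiamondPrinciple : Prop :=
  ∃ D : Ordinal.{0} → Set Ordinal.{0}, IsDiamondSequence D

end ConstructionScheme

/-! For each ξ < ω₁ one builds an increasing chain `E ξ` of finite sets of sizes m_0, m_1, … with
union ω·(ξ+1); the scheme consists of the members of the chains and their iterated pieces. Below
ω·ξ, each member of `E ξ` is an initial segment of a set of the same level coming from earlier
chains; above, it is an interval starting at ω·ξ. This shape gives, by induction on ξ, that two sets
of one level meet in a common initial segment (`Lev.coherent`).

Capturing comes from a greedy choice. Finite sets are coded by countable ordinals, so ◇ provides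
guesses `S ξ` for the part of 𝒮 below ω·ξ. Given positions t, at suitable levels k + 1 the set `E ξ
k` has exactly its root below ω·ξ; `E ξ (k + 1)` puts below it as many pieces j < n_{k+1} with
t-part in `S ξ` as the earlier scheme allows (`Act`). Suppose the guess at ξ is correct, and take A
∈ 𝒮 not below ω·ξ, inside some `E ζ` with ζ ≥ ξ. If `E ζ` repeats the choice of `E ξ` for the
positions of A, then j copies lie in 𝒮 by the guess and A is the copy of index j
(`exists_candidate`). If ω·ξ is also a closure point, the same configuration over the same root
occurs for some ζ₀ < ξ, so j + 1 copies were already available below ω·ξ. Maximality of j leaves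
only j + 1 = n_{k+1}, which is full capture (`Candidate.succ_eq`).

Thus every `E ξ` has to perform the greedy choices of all η ≤ ξ. It is built from finite paths
meeting countably many requirements (`exists_generic`). Idle intervals, in which a chain only
end-extends while all small root sizes occur at levels in P, let a path reach a level whose root is
exactly its part below ω·ξ. There it can seal for ξ (`Path.secure_self`), or absorb ω·γ
(`Path.attach`) and from then on imitate `E γ` (`Path.copy`), inheriting its choices for every η ≤
γ. -/

namespace ConstructionScheme

/-! ### Positions of pieces -/

namespace SchemeType

variable (τ : SchemeType)

/-- The position in a set of level `k + 1` of the `s`-th element of its `i`-th piece. -/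
def shift (k i s : ℕ) : ℕ :=
  if s < τ.r (k + 1) then s else s + i * (τ.m k - τ.r (k + 1))

variable {τ} {k i i' j s s' : ℕ}

theorem shift_of_lt (h : s < τ.r (k + 1)) : τ.shift k i s = s := by simp [shift, h]

theorem shift_of_le (h : τ.r (k + 1) ≤ s) :
    τ.shift k i s = s + i * (τ.m k - τ.r (k + 1)) := by simp [shift, h.not_gt]

@[simp]
theorem shift_zero : τ.shift k 0 s = s := by simp [shift]

theorem shift_strictMono (k i : ℕ) : StrictMono (τ.shift k i) := by
  intro a b hab
  unfold shift
  split_ifs <;> omega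

theorem le_shift : s ≤ τ.shift k i s := (shift_strictMono k i).le_apply

theorem shift_lt_of_lt (hs : s < τ.m k) (hij : i < j) :
    τ.shift k i s < τ.r (k + 1) + j * (τ.m k - τ.r (k + 1)) := by
  have hr := τ.r_lt_m k
  have : (i + 1) * (τ.m k - τ.r (k + 1)) ≤ j * (τ.m k - τ.r (k + 1)) :=
    Nat.mul_le_mul_right _ hij
  rw [add_mul] at this
  unfold shift
  split_ifs <;> omega

theorem shift_lt (hs : s < τ.m k) (hi : i < τ.n (k + 1)) : τ.shift k i s < τ.m (k + 1) := by
  rw [τ.m_succ, mul_comm]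
  exact shift_lt_of_lt hs hi

/-- The tails of distinct pieces occupy disjoint blocks of positions above the root, so two pieces
share root positions only. -/
theorem shift_eq_shift (hs : s < τ.m k) (hs' : s' < τ.m k) (h : τ.shift k i s = τ.shift k i' s') :
    s = s' ∧ (i = i' ∨ s < τ.r (k + 1)) := by
  have hr := τ.r_lt_m k
  by_cases h1 : s < τ.r (k + 1)
  · by_cases h2 : s' < τ.r (k + 1)
    · rw [shift_of_lt h1, shift_of_lt h2] at h; exact ⟨h, Or.inr h1⟩
    · rw [shift_of_lt h1, shift_of_le (not_lt.1 h2)] at h; omega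
  · by_cases h2 : s' < τ.r (k + 1)
    · rw [shift_of_le (not_lt.1 h1), shift_of_lt h2] at h; omega
    · rcases lt_trichotomy i i' with hi | hi | hi
      · have := shift_lt_of_lt hs hi
        rw [h, shift_of_le (not_lt.1 h2)] at this; omega
      · subst hi; exact ⟨(shift_strictMono k i).injective h, Or.inl rfl⟩
      · have := shift_lt_of_lt hs' hi
        rw [← h, shift_of_le (not_lt.1 h1)] at this; omega

theorem exists_shift_eq (hs : s < τ.m (k + 1)) :
    ∃ i < τ.n (k + 1), ∃ q < τ.m k, τ.shift k i q = s := by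
  have hr := τ.r_lt_m k
  have hn := τ.two_le_n k
  by_cases h : s < τ.r (k + 1)
  · exact ⟨0, by omega, s, by omega, by simp⟩
  · set d := τ.m k - τ.r (k + 1) with hd
    have hd0 : 0 < d := by omega
    have e := Nat.div_add_mod (s - τ.r (k + 1)) d
    have hlt := Nat.mod_lt (s - τ.r (k + 1)) hd0
    rw [τ.m_succ, ← hd] at hs
    refine ⟨(s - τ.r (k + 1)) / d, ?_, τ.r (k + 1) + (s - τ.r (k + 1)) % d, by omega, ?_⟩
    · rw [Nat.div_lt_iff_lt_mul hd0, mul_comm]; omega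
    · rw [shift_of_le (by omega), ← hd, mul_comm]; omega

theorem m_pos (k : ℕ) : 0 < τ.m k := (Nat.zero_le _).trans_lt (τ.r_lt_m k)

theorem m_lt_m_succ (k : ℕ) : τ.m k < τ.m (k + 1) := by
  have hr := τ.r_lt_m k
  have : (τ.m k - τ.r (k + 1)) * 2 ≤ (τ.m k - τ.r (k + 1)) * τ.n (k + 1) :=
    Nat.mul_le_mul_left _ (τ.two_le_n k)
  rw [τ.m_succ]; omega

theorem m_strictMono : StrictMono τ.m := strictMono_nat_of_lt_succ m_lt_m_succ

theorem m_add_le (k d : ℕ) : τ.m k + d ≤ τ.m (k + d) := by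
  induction d with
  | zero => simp
  | succ d ih => 
    have := m_lt_m_succ (τ := τ) (k + d)
    change τ.m k + (d + 1) ≤ τ.m (k + d + 1)
    omega

end SchemeType

/-! ### Iterated pieces as maps of positions -/

open SchemeType

/-- `SubEmb τ k j σ`: the map `σ` enumerates the positions, in a set of level `j`, of one of its
subsets of level `k`. -/
inductive SubEmb (τ : SchemeType) (k : ℕ) : ℕ → (ℕ → ℕ) → Prop
  | refl : SubEmb τ k k id
  | step {j i : ℕ} {σ : ℕ → ℕ} : SubEmb τ k j σ → i < τ.n (j + 1) →
      SubEmb τ k (j + 1) (τ.shift j i ∘ σ)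

namespace SubEmb

variable {τ : SchemeType} {k j l : ℕ} {σ σ' : ℕ → ℕ}

theorem le (h : SubEmb τ k j σ) : k ≤ j := by
  induction h with
  | refl => rfl
  | step _ _ ih => omega

theorem strictMono (h : SubEmb τ k j σ) : StrictMono σ := by
  induction h with
  | refl => exact strictMono_id
  | step _ _ ih => exact (shift_strictMono _ _).comp ih

theorem lt (h : SubEmb τ k j σ) : ∀ {s}, s < τ.m k → σ s < τ.m j := by
  induction h with
  | refl => exact fun h => h
  | step _ hi ih => exact fun h => shift_lt (ih h) hi

theorem comp (h : SubEmb τ k j σ) (h' : SubEmb τ j l σ') : SubEmb τ k l (σ' ∘ σ) := by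
  induction h' with
  | refl => exact h
  | step _ hi ih => exact ih.step hi

theorem shift {i : ℕ} (hi : i < τ.n (k + 1)) : SubEmb τ k (k + 1) (τ.shift k i) :=
  refl.step hi

theorem eq_of_le (h : SubEmb τ k j σ) (h' : j ≤ k) : σ = id := by
  cases h with
  | refl => rfl
  | step h _ => have := h.le; omega

/-- Induction on the upper level: equal positions lie either in one piece or in the root, and below
a root position all pieces coincide. -/
theorem coherent (h : SubEmb τ k j σ) (h' : SubEmb τ k j σ') {a b : ℕ} (ha : a < τ.m k)
    (hb : b < τ.m k) (hab : σ a = σ' b) : a = b ∧ ∀ c ≤ a, σ c = σ' c := by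
  induction h generalizing σ' with
  | refl =>
    rw [h'.eq_of_le le_rfl] at hab ⊢
    exact ⟨hab, fun _ _ => rfl⟩
  | @step j i σ₁ h₁ hi ih =>
    cases h' with
    | refl => have := h₁.le; omega
    | @step _ i' σ₂ h₂ hi' =>
      obtain ⟨e, hc⟩ := shift_eq_shift (h₁.lt ha) (h₂.lt hb) hab
      obtain ⟨rfl, hs⟩ := ih h₂ e
      refine ⟨rfl, fun c hca => ?_⟩
      rcases hc with rfl | hc
      · simp [hs c hca]
      · have hlt : σ₁ c < τ.r (j + 1) := (h₁.strictMono.monotone hca).trans_lt hc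
        simp only [Function.comp]
        rw [shift_of_lt hlt, shift_of_lt (by rwa [← hs c hca]), hs c hca]

theorem exists_eq (hkj : k ≤ j) : ∀ {p : ℕ}, p < τ.m j →
    ∃ σ, SubEmb τ k j σ ∧ ∃ q < τ.m k, σ q = p := by
  induction j, hkj using Nat.le_induction with
  | base => exact fun {p} hp => ⟨id, refl, p, hp, rfl⟩
  | succ j _ ih =>
    intro p hp
    obtain ⟨i, hi, q, hq, rfl⟩ := exists_shift_eq hp
    obtain ⟨σ, hσ, q', hq', rfl⟩ := ih hq
    exact ⟨_, hσ.step hi, q', hq', rfl⟩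

end SubEmb

/-! ### Chains generating a scheme -/

/-- The sets of level `k` of the scheme over `ω * ξ` generated by the chains `E η`, `η < ξ`, each
given by an enumeration of which only the first `m_k` values matter. -/
def Lev (τ : SchemeType) (E : Ordinal.{0} → ℕ → ℕ → Ordinal.{0}) (ξ : Ordinal.{0}) (k : ℕ) :
    Set (ℕ → Ordinal.{0}) :=
  {f | ∃ η < ξ, ∃ j σ, SubEmb τ k j σ ∧ f = E η j ∘ σ}

/-- `E ξ` is an increasing chain of sets with union `ω * (ξ + 1)`; its `k`-th member has size `m_k`,
is a piece of the next one, and consists of an initial segment of a set of level `k` of the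
scheme over `ω * ξ`, followed by an initial segment of `[ω * ξ, ω * ξ + ω)`. -/
structure IsChain (τ : SchemeType) (E : Ordinal.{0} → ℕ → ℕ → Ordinal.{0}) (ξ : Ordinal.{0}) :
    Prop where
  valid : ∀ k, ∃ a < τ.m k, (∀ s, a ≤ s → E ξ k s = ω * ξ + ((s - a : ℕ) : Ordinal.{0})) ∧
    (0 < a → ∃ f ∈ Lev τ E ξ k, ∀ s < a, E ξ k s = f s)
  chain : ∀ k, ∃ i < τ.n (k + 1), ∀ s < τ.m k, E ξ k s = E ξ (k + 1) (τ.shift k i s)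
  cover : ∀ x < ω * (ξ + 1), ∃ k, ∃ s < τ.m k, E ξ k s = x

section Lev

variable {τ : SchemeType} {E E' : Ordinal.{0} → ℕ → ℕ → Ordinal.{0}} {ξ η ζ : Ordinal.{0}}
  {k l : ℕ} {f g : ℕ → Ordinal.{0}} {σ : ℕ → ℕ}

theorem Lev.mem (h : η < ξ) (k : ℕ) : E η k ∈ Lev τ E ξ k :=
  ⟨η, h, k, id, .refl, rfl⟩

theorem Lev.mono (h : η ≤ ξ) (hf : f ∈ Lev τ E η k) : f ∈ Lev τ E ξ k := by
  obtain ⟨η', h', r⟩ := hf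
  exact ⟨η', h'.trans_le h, r⟩

theorem Lev.comp (hf : f ∈ Lev τ E ξ l) (hσ : SubEmb τ k l σ) : f ∘ σ ∈ Lev τ E ξ k := by
  obtain ⟨η, h, j, σ', hσ', rfl⟩ := hf
  exact ⟨η, h, j, _, hσ.comp hσ', rfl⟩

theorem Lev.congr (h : ∀ η < ξ, E η = E' η) : Lev τ E ξ = Lev τ E' ξ := by
  ext k f
  constructor
  · rintro ⟨η, hη, j, σ, hσ, rfl⟩
    exact ⟨η, hη, j, σ, hσ, by rw [h η hη]⟩
  · rintro ⟨η, hη, j, σ, hσ, rfl⟩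
    exact ⟨η, hη, j, σ, hσ, by rw [h η hη]⟩

theorem IsChain.exists_subEmb (h : IsChain τ E ξ) (hkl : k ≤ l) :
    ∃ σ, SubEmb τ k l σ ∧ ∀ s < τ.m k, E ξ k s = E ξ l (σ s) := by
  induction l, hkl using Nat.le_induction with
  | base => exact ⟨id, .refl, fun _ _ => rfl⟩
  | succ l _ ih =>
    obtain ⟨σ, hσ, hs⟩ := ih
    obtain ⟨i, hi, hi'⟩ := h.chain l
    exact ⟨_, hσ.step hi, fun s h => by rw [hs s h, hi' _ (hσ.lt h)]; rfl⟩

theorem mul_omega_add_one : ω * (ξ + 1) = ω * ξ + ω := by rw [mul_add, mul_one]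

theorem omega_mul_lt_mul_succ : ω * ξ < ω * (ξ + 1) :=
  (mul_lt_mul_iff_right₀ omega0_pos).2 (lt_add_one ξ)

theorem IsChain.lt_of_forall_lev (h : IsChain τ E ξ)
    (hL : ∀ k, ∀ f ∈ Lev τ E ξ k, ∀ s < τ.m k, f s < ω * ξ) :
    ∀ k, ∀ s, s < τ.m k → E ξ k s < ω * (ξ + 1) := by
  intro k s hs
  obtain ⟨a, ha, h1, h2⟩ := h.valid k
  by_cases hsa : s < a
  · obtain ⟨f, hf, hf'⟩ := h2 (by omega)
    rw [hf' s hsa]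
    exact (hL k f hf s hs).trans omega_mul_lt_mul_succ
  · rw [h1 s (not_lt.1 hsa), mul_omega_add_one]
    exact (add_lt_add_iff_left _).2 (natCast_lt_omega0 _)

theorem Lev.lt (h : ∀ η < ξ, IsChain τ E η) : ∀ k, ∀ f ∈ Lev τ E ξ k, ∀ s < τ.m k, f s < ω * ξ := by
  induction ξ using WellFoundedLT.induction with
  | _ ξ ih =>
    rintro k _ ⟨η, hη, j, σ, hσ, rfl⟩ s hs
    refine ((h η hη).lt_of_forall_lev (ih η hη fun ζ hζ => h ζ (hζ.trans hη)) j _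
      (hσ.lt hs)).trans_le ?_
    exact mul_le_mul_right (Order.add_one_le_of_lt hη) _

theorem IsChain.strictMonoOn (h : IsChain τ E ξ)
    (hL : ∀ k, ∀ f ∈ Lev τ E ξ k, ∀ s < τ.m k, f s < ω * ξ)
    (hM : ∀ k, ∀ f ∈ Lev τ E ξ k, StrictMonoOn f (Set.Iio (τ.m k))) (k : ℕ) :
    StrictMonoOn (E ξ k) (Set.Iio (τ.m k)) := by
  intro s hs s' hs' hss
  rw [Set.mem_Iio] at hs hs'
  obtain ⟨a, ha, h1, h2⟩ := h.valid k
  by_cases hsa : s < a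
  · obtain ⟨f, hf, hf'⟩ := h2 (by omega)
    rw [hf' s hsa]
    by_cases hsa' : s' < a
    · rw [hf' s' hsa']; exact hM k f hf hs hs' hss
    · rw [h1 s' (not_lt.1 hsa')]
      exact (hL k f hf s hs).trans_le le_self_add
  · rw [h1 s (not_lt.1 hsa), h1 s' (by omega)]
    refine (add_lt_add_iff_left _).2 (Nat.cast_lt.2 (by omega))

theorem Lev.strictMonoOn (h : ∀ η < ξ, IsChain τ E η) :
    ∀ k, ∀ f ∈ Lev τ E ξ k, StrictMonoOn f (Set.Iio (τ.m k)) := by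
  induction ξ using WellFoundedLT.induction with
  | _ ξ ih =>
    rintro k _ ⟨η, hη, j, σ, hσ, rfl⟩
    have hb : ∀ ζ < η, IsChain τ E ζ := fun ζ hζ => h ζ (hζ.trans hη)
    exact ((h η hη).strictMonoOn (Lev.lt hb) (ih η hη hb) j).comp
      (hσ.strictMono.strictMonoOn _) fun s hs => hσ.lt hs

/-- Two sets of the same level meet in a common initial segment. -/
def Coherent (m : ℕ) (f g : ℕ → Ordinal.{0}) : Prop :=
  ∀ a < m, ∀ b < m, f a = g b → a = b ∧ ∀ c ≤ a, f c = g c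

theorem Coherent.symm {m : ℕ} (h : Coherent m f g) : Coherent m g f := by
  intro a ha b hb e
  obtain ⟨rfl, h'⟩ := h b hb a ha e.symm
  exact ⟨rfl, fun c hc => (h' c hc).symm⟩

/-- A common value belongs to g and so is below ω·ξ. It therefore lies in the part of `E ξ j` copied
from an earlier set, where coherence is already known. -/
theorem coherent_of_lt (h : ∀ η ≤ ξ, IsChain τ E η) {j : ℕ}
    (hC : ∀ k, ∀ f ∈ Lev τ E ξ k, ∀ g ∈ Lev τ E ξ k, Coherent (τ.m k) f g)
    (hg : g ∈ Lev τ E ξ k) (hσ : SubEmb τ k j σ) : Coherent (τ.m k) g (E ξ j ∘ σ) := by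
  intro a ha b hb e
  obtain ⟨c, hc, h1, h2⟩ := (h ξ le_rfl).valid j
  have hlt := Lev.lt (fun η hη => h η hη.le) k g hg a ha
  have hbc : σ b < c := by
    by_contra hbc
    rw [e, Function.comp, h1 _ (not_lt.1 hbc)] at hlt
    exact absurd hlt (not_lt.2 le_self_add)
  obtain ⟨f, hf, hf'⟩ := h2 (by omega)
  obtain ⟨rfl, h3⟩ := hC k g hg _ (Lev.comp hf hσ) a ha b hb
    (e.trans (hf' _ hbc))
  refine ⟨rfl, fun s hs => ?_⟩
  exact (h3 s hs).trans (hf' _ ((hσ.strictMono.monotone hs).trans_lt hbc)).symm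

theorem Lev.coherent (h : ∀ η < ξ, IsChain τ E η) :
    ∀ k, ∀ f ∈ Lev τ E ξ k, ∀ g ∈ Lev τ E ξ k, Coherent (τ.m k) f g := by
  induction ξ using WellFoundedLT.induction with
  | _ ξ ih =>
    rintro k _ ⟨η, hη, j, σ, hσ, rfl⟩ _ ⟨ζ, hζ, j', σ', hσ', rfl⟩
    rcases lt_trichotomy η ζ with hlt | rfl | hlt
    · exact coherent_of_lt (fun x hx => h x (hx.trans_lt hζ))
        (ih ζ hζ fun x hx => h x (hx.trans hζ)) ⟨η, hlt, j, σ, hσ, rfl⟩ hσ'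
    · have hb : ∀ ζ < η, IsChain τ E ζ := fun ζ hζ => h ζ (hζ.trans hη)
      -- Two pieces of the same chain lie in a common member, where injectivity reduces the claim to
      -- positions.
      obtain ⟨θ, hθ, e⟩ := (h η hη).exists_subEmb (le_max_left j j')
      obtain ⟨θ', hθ', e'⟩ := (h η hη).exists_subEmb (le_max_right j j')
      have hM := ((h η hη).strictMonoOn (Lev.lt hb) (Lev.strictMonoOn hb) (max j j')).injOn
      intro a ha b hb hab
      simp only [Function.comp] at hab ⊢
      rw [e _ (hσ.lt ha), e' _ (hσ'.lt hb)] at hab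
      obtain ⟨rfl, hc⟩ := (hσ.comp hθ).coherent (hσ'.comp hθ') ha hb
        (hM (hθ.lt (hσ.lt ha)) (hθ'.lt (hσ'.lt hb)) hab)
      refine ⟨rfl, fun c hca => ?_⟩
      rw [e _ (hσ.lt (hca.trans_lt ha)), e' _ (hσ'.lt (hca.trans_lt ha))]
      exact congrArg _ (hc c hca)
    · exact (coherent_of_lt (fun x hx => h x (hx.trans_lt hη))
        (ih η hη fun x hx => h x (hx.trans hη)) ⟨ζ, hlt, j', σ', hσ', rfl⟩ hσ).symm

theorem exists_lt_mul_succ {x : Ordinal.{0}} (hx : x < ω * ξ) : ∃ η < ξ, x < ω * (η + 1) :=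
  ⟨x / ω, (lt_mul_iff_div_lt omega0_ne_zero).1 hx, by
    simpa [Order.succ_eq_add_one] using lt_mul_succ_div x omega0_ne_zero⟩

theorem exists_forall_lt_mul_succ (hξ : 0 < ξ) (B : Finset Ordinal.{0}) (hB : ∀ x ∈ B, x < ω * ξ) :
    ∃ η < ξ, ∀ x ∈ B, x < ω * (η + 1) := by
  induction B using Finset.induction_on with
  | empty => exact ⟨0, hξ, by simp⟩
  | insert x B _ ih =>
    obtain ⟨η, hη, h1⟩ := ih fun y hy => hB y (Finset.mem_insert_of_mem hy)
    obtain ⟨ζ, hζ, h2⟩ := exists_lt_mul_succ (hB x (Finset.mem_insert_self _ _))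
    have key : ∀ {a y : Ordinal.{0}}, a ≤ max η ζ → y < ω * (a + 1) → y < ω * (max η ζ + 1) :=
      fun ha hy => hy.trans_le (mul_le_mul_right (add_le_add_left ha 1) _)
    refine ⟨max η ζ, max_lt hη hζ, fun y hy => ?_⟩
    rcases Finset.mem_insert.1 hy with rfl | hy
    · exact key (le_max_right _ _) h2
    · exact key (le_max_left _ _) (h1 y hy)

theorem IsChain.exists_forall_mem (h : IsChain τ E ξ) (B : Finset Ordinal.{0})
    (hB : ∀ x ∈ B, x < ω * (ξ + 1)) (N : ℕ) :
    ∃ k ≥ N, ∀ l ≥ k, ∀ x ∈ B, ∃ s < τ.m l, E ξ l s = x := by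
  induction B using Finset.induction_on with
  | empty => exact ⟨N, le_rfl, by simp⟩
  | insert x B _ ih =>
    obtain ⟨k, hk, h1⟩ := ih fun y hy => hB y (Finset.mem_insert_of_mem hy)
    obtain ⟨k', s, hs, hx⟩ := h.cover x (hB x (Finset.mem_insert_self _ _))
    refine ⟨max k k', hk.trans (le_max_left _ _), fun l hl y hy => ?_⟩
    rcases Finset.mem_insert.1 hy with rfl | hy
    · obtain ⟨σ, hσ, e⟩ := h.exists_subEmb ((le_max_right _ _).trans hl)
      exact ⟨σ s, hσ.lt hs, by rw [← e s hs, hx]⟩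
    · exact h1 l ((le_max_left _ _).trans hl) y hy

/-- A set of level `k` contained in a set of level `l ≥ k` occurs there at a canonical position. -/
theorem Lev.exists_subEmb (h : ∀ η < ξ, IsChain τ E η) (hf : f ∈ Lev τ E ξ k)
    (hg : g ∈ Lev τ E ξ l) (hkl : k ≤ l) (hfg : ∀ s < τ.m k, ∃ p < τ.m l, g p = f s) :
    ∃ σ, SubEmb τ k l σ ∧ ∀ s < τ.m k, f s = g (σ s) := by
  have hm := τ.m_pos k
  -- Locating the last element of f suffices: coherence determines everything below it.
  obtain ⟨p, hp, e⟩ := hfg (τ.m k - 1) (by omega)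
  obtain ⟨σ, hσ, q, hq, rfl⟩ := SubEmb.exists_eq hkl hp
  obtain ⟨-, h2⟩ := Lev.coherent h k f hf _ (Lev.comp hg hσ) (τ.m k - 1) (by omega) q hq e.symm
  exact ⟨σ, hσ, fun s hs => h2 s (by omega)⟩

end Lev

/-! ### Sealing -/

/-- At level `k + 1` the chain `e` adds to `e k`, which meets `b` in a set of size `r_{k+1}`, as many
pieces below it with `t`-part in `S` as the scheme `L` below `b` permits. -/
structure Act (τ : SchemeType) (L : ℕ → Set (ℕ → Ordinal.{0})) (S : Set (Finset Ordinal.{0}))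
    (b : Ordinal.{0}) (e : ℕ → ℕ → Ordinal.{0}) (k : ℕ) (t : Finset ℕ) (j : ℕ) : Prop where
  lt : j < τ.n (k + 1)
  base : e k (τ.r (k + 1)) = b
  piece : ∀ s < τ.m k, e k s = e (k + 1) (τ.shift k j s)
  mem : ∀ i < j, t.image (fun s => e (k + 1) (τ.shift k i s)) ∈ S
  max : ∀ q < τ.n (k + 1), ∀ H ∈ L (k + 1), (∀ s < τ.r (k + 1), H s = e k s) →
    (∀ i < q, t.image (fun s => H (τ.shift k i s)) ∈ S) → q ≤ j

/-- From level `u` to level `v` the chain `e` grows only by end-extensions, and every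
number `c ≤ m_u` occurs as some `r_l` with `l ∈ P` in between. -/
def Idle (τ : SchemeType) (P : Set ℕ) (e : ℕ → ℕ → Ordinal.{0}) (u v : ℕ) : Prop :=
  (∀ c ≤ τ.m u, ∃ l ∈ P, u < l ∧ l ≤ v ∧ τ.r l = c) ∧
    ∀ k, u ≤ k → k < v → ∀ s < τ.m k, e k s = e (k + 1) s

/-- The set of positions `t₀` of `e k₀` becomes the set of positions `t` of `e k`, where `k ≥ N`,
`k + 1 ∈ P` and `Act'` holds. -/
def Serves (τ : SchemeType) (Act' : ℕ → Finset ℕ → ℕ → Prop) (P : Set ℕ)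
    (e : ℕ → ℕ → Ordinal.{0}) (k₀ : ℕ) (t₀ : Finset ℕ) (N : ℕ) : Prop :=
  ∃ k, k₀ ≤ k ∧ N ≤ k ∧ k + 1 ∈ P ∧ ∃ j t, (∀ s ∈ t, s < τ.m k) ∧ Act' k t j ∧
    (∀ s < τ.m k, e k s = e (k + 1) (τ.shift k j s)) ∧ t.image (e k) = t₀.image (e k₀)

/-- The inductive hypotheses on the chain `E ξ`, relative to the guesses `S` and the sets `Pf p`. -/
structure Stage (τ : SchemeType) (Pf : ℕ → Set ℕ) (S : Ordinal.{0} → Set (Finset Ordinal.{0}))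
    (E : Ordinal.{0} → ℕ → ℕ → Ordinal.{0}) (ξ : Ordinal.{0}) : Prop extends IsChain τ E ξ where
  idle : ∀ p N, ∃ u ≥ N, ∃ v ≥ u + N, Idle τ (Pf p) (E ξ) u v
  act : ∀ η, 0 < η → η ≤ ξ → ∀ k₀ (t₀ : Finset ℕ), (∀ s ∈ t₀, s < τ.m k₀) → ∀ p N,
    Serves τ (Act τ (Lev τ E η) (S η) (ω * η) (E η)) (Pf p) (E ξ) k₀ t₀ N

/-! ### Finite paths -/

/-- `e` consists of the first `a` elements of a set of level `k` of `L`, followed by the ordinals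
`b, b + 1, …`. -/
structure State (τ : SchemeType) (L : ℕ → Set (ℕ → Ordinal.{0})) (b : Ordinal.{0}) (k : ℕ)
    (e : ℕ → Ordinal.{0}) (a : ℕ) : Prop where
  lt : a < τ.m k
  tail : ∀ s, a ≤ s → e s = b + ((s - a : ℕ) : Ordinal.{0})
  base : ∃ f ∈ L k, ∀ s < a, e s = f s

/-- The initial part, up to level `k`, of a chain to be constructed. -/
structure Path (τ : SchemeType) (L : ℕ → Set (ℕ → Ordinal.{0})) (b : Ordinal.{0}) (k : ℕ)
    (e : ℕ → ℕ → Ordinal.{0}) : Prop where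
  state : ∀ j ≤ k, ∃ a, State τ L b j (e j) a
  chain : ∀ j < k, ∃ i < τ.n (j + 1), ∀ s < τ.m j, e j s = e (j + 1) (τ.shift j i s)

section Path

variable {τ : SchemeType} {L : ℕ → Set (ℕ → Ordinal.{0})} {b : Ordinal.{0}} {k v a i : ℕ}
  {e : ℕ → ℕ → Ordinal.{0}} {f h : ℕ → Ordinal.{0}}

theorem Path.exists_subEmb (hp : Path τ L b v e) (hk : k ≤ v) :
    ∃ σ, SubEmb τ k v σ ∧ ∀ s < τ.m k, e k s = e v (σ s) := by
  suffices ∀ l, k ≤ l → l ≤ v → ∃ σ, SubEmb τ k l σ ∧ ∀ s < τ.m k, e k s = e l (σ s) from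
    this v hk le_rfl
  intro l hkl
  induction l, hkl using Nat.le_induction with
  | base => exact fun _ => ⟨id, .refl, fun _ _ => rfl⟩
  | succ l _ ih =>
    intro hl
    obtain ⟨σ, hσ, hs⟩ := ih (by omega)
    obtain ⟨i, hi, hi'⟩ := hp.chain l (by omega)
    exact ⟨_, hσ.step hi, fun s h => by rw [hs s h, hi' _ (hσ.lt h)]; rfl⟩

/-- Extension of a path by one level. -/
theorem Path.move (hp : Path τ L b k e) (hs : State τ L b k (e k) a) (hf : f ∈ L (k + 1))
    (hi : i < τ.n (k + 1)) (hia : i = 0 ∨ τ.r (k + 1) ≤ a)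
    (hfe : ∀ s < a, e k s = f (τ.shift k i s)) :
    ∃ e', Path τ L b (k + 1) e' ∧ (∀ j ≤ k, e' j = e j) ∧
      State τ L b (k + 1) (e' (k + 1)) (a + i * (τ.m k - τ.r (k + 1))) ∧
      (∀ s < a + i * (τ.m k - τ.r (k + 1)), e' (k + 1) s = f s) ∧
      ∀ s < τ.m k, e' k s = e' (k + 1) (τ.shift k i s) := by
  set a' := a + i * (τ.m k - τ.r (k + 1)) with ha'
  set g : ℕ → Ordinal.{0} := fun s => if s < a' then f s else b + ((s - a' : ℕ) : Ordinal.{0})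
    with hg
  have hr := τ.r_lt_m k
  have ha := hs.lt
  have hlt : a' < τ.m (k + 1) := by
    have : (i + 1) * (τ.m k - τ.r (k + 1)) ≤ τ.n (k + 1) * (τ.m k - τ.r (k + 1)) :=
      Nat.mul_le_mul_right _ hi
    rw [τ.m_succ, mul_comm (τ.m k - _)]
    rw [add_mul] at this
    omega
  have hst : State τ L b (k + 1) g a' :=
    ⟨hlt, fun s h => by simp [hg, h.not_gt], f, hf, fun s h => by simp [hg, h]⟩
  have hpc : ∀ s < τ.m k, e k s = g (τ.shift k i s) := by
    intro s hsm
    by_cases hsa : s < a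
    · have : τ.shift k i s < a' := by unfold SchemeType.shift; split_ifs <;> omega
      rw [hfe s hsa, hg]
      simp [this]
    -- For i = 0 no position moves. Otherwise r ≤ a ≤ s, so s is outside the root and is translated
    -- by the same amount as the boundary a.
    · have : a' ≤ τ.shift k i s ∧ τ.shift k i s - a' = s - a := by
        rcases hia with rfl | hia
        · simp [ha']; omega
        · rw [shift_of_le (by omega)]; omega
      rw [hs.tail s (not_lt.1 hsa), hg]
      simp [this.1.not_gt, this.2]
  refine ⟨Function.update e (k + 1) g, ⟨fun j hj => ?_, fun j hj => ?_⟩, fun j hj => ?_, ?_, ?_, ?_⟩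
  · rcases hj.eq_or_lt with rfl | hj
    · exact ⟨a', by simpa using hst⟩
    · rw [Function.update_of_ne hj.ne]; exact hp.state j (by omega)
  · rcases (Nat.lt_succ_iff.1 hj).eq_or_lt with rfl | hj
    · exact ⟨i, hi, by simpa using hpc⟩
    · rw [Function.update_of_ne (by omega), Function.update_of_ne (by omega)]
      exact hp.chain j hj
  · rw [Function.update_of_ne (by omega)]
  · simpa using hst
  · intro s h; simp [hg, h]
  · simpa using hpc

/-- The path climbs through the pieces leading to h, so that its old part stays an initial segment
of the current target. -/
theorem Path.follow (hL : ∀ k, ∀ f ∈ L (k + 1), ∀ i < τ.n (k + 1), f ∘ τ.shift k i ∈ L k)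
    (hp : Path τ L b k e) (hs : State τ L b k (e k) a) {σ : ℕ → ℕ} (hσ : SubEmb τ k v σ)
    (hh : h ∈ L v) (he : ∀ s < a, e k s = h (σ s)) :
    ∃ e' a', Path τ L b v e' ∧ (∀ j ≤ k, e' j = e j) ∧ State τ L b v (e' v) a' ∧
      ∀ s < a', e' v s = h s := by
  induction hσ generalizing h with
  | refl => exact ⟨e, a, hp, fun _ _ => rfl, hs, he⟩
  | @step v i σ hσ hi ih =>
    obtain ⟨e₁, a₁, hp₁, hag, hs₁, hf₁⟩ := ih (hL v h hh i hi) he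
    have hn := τ.two_le_n v
    by_cases hia : i = 0 ∨ τ.r (v + 1) ≤ a₁
    · obtain ⟨e₂, hp₂, hag₂, hs₂, hf₂, -⟩ := hp₁.move hs₁ hh hi hia hf₁
      exact ⟨e₂, _, hp₂, fun j hj => (hag₂ j (hj.trans hσ.le)).trans (hag j hj), hs₂, hf₂⟩
    -- The old part lies inside the root, which all pieces share, so index 0 can replace i; index i
    -- would move new elements beyond the root but not those inside it.
    · push Not at hia
      obtain ⟨e₂, hp₂, hag₂, hs₂, hf₂, -⟩ := hp₁.move (i := 0) hs₁ hh (by omega) (Or.inl rfl)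
        (fun s hs => by
          rw [hf₁ s hs, shift_zero, Function.comp, shift_of_lt (hs.trans hia.2)])
      exact ⟨e₂, _, hp₂, fun j hj => (hag₂ j (hj.trans hσ.le)).trans (hag j hj), hs₂, hf₂⟩

/-- Using index 0 throughout keeps the number a of old elements constant while the root size varies.
A later level with r = a can then be chosen. -/
theorem Path.idle (hp : Path τ L b k e) (hs : State τ L b k (e k) a) {g : ℕ → ℕ → Ordinal.{0}}
    (hg : ∀ j, g j ∈ L j) (he : ∀ s < a, e k s = g k s) (hkv : k ≤ v)
    (hidle : ∀ j, k ≤ j → j < v → ∀ s < τ.m j, g j s = g (j + 1) s) :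
    ∃ e', Path τ L b v e' ∧ (∀ j ≤ k, e' j = e j) ∧ State τ L b v (e' v) a ∧
      (∀ s < a, e' v s = g v s) ∧
      ∀ j, k ≤ j → j < v → ∀ s < τ.m j, e' j s = e' (j + 1) s := by
  induction v, hkv using Nat.le_induction with
  | base => exact ⟨e, hp, fun _ _ => rfl, hs, he, fun j h h' => by omega⟩
  | succ v hkv ih =>
    obtain ⟨e₁, hp₁, hag, hs₁, hf₁, hi₁⟩ := ih fun j h h' => hidle j h (by omega)
    have hn := τ.two_le_n v
    obtain ⟨e₂, hp₂, hag₂, hs₂, hf₂, hi₂⟩ := hp₁.move (i := 0) hs₁ (hg (v + 1)) (by omega)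
      (Or.inl rfl) (fun s hs => by
        rw [hf₁ s hs, shift_zero, hidle v hkv (by omega) s (hs.trans hs₁.lt)])
    simp only [zero_mul, add_zero, shift_zero] at hs₂ hf₂ hi₂
    refine ⟨e₂, hp₂, fun j hj => (hag₂ j (hj.trans hkv)).trans (hag j hj), hs₂, hf₂, ?_⟩
    intro j hj hjv
    rcases (Nat.lt_succ_iff.1 hjv).eq_or_lt with rfl | hjv
    · exact hi₂
    · rw [hag₂ j hjv.le, hag₂ (j + 1) hjv]
      exact hi₁ j hj hjv

end Path

/-! ### Steering a path along earlier chains -/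

section Stage

variable {τ : SchemeType} {Pf : ℕ → Set ℕ} {S : Ordinal.{0} → Set (Finset Ordinal.{0})}
  {E : Ordinal.{0} → ℕ → ℕ → Ordinal.{0}} {ξ γ : Ordinal.{0}} {k v a : ℕ}
  {e : ℕ → ℕ → Ordinal.{0}}

theorem Lev.piece : ∀ k, ∀ f ∈ Lev τ E ξ (k + 1), ∀ i < τ.n (k + 1),
    f ∘ τ.shift k i ∈ Lev τ E ξ k :=
  fun _ _ hf _ hi => Lev.comp hf (.shift hi)

/-- From ω·ξ on, both members list consecutive ordinals. If ω·ξ is in the root, it has the same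
position in both; comparing the last element of the piece then excludes a translation. -/
theorem IsChain.shift_eq_zero (h : ∀ η ≤ ξ, IsChain τ E η) {c i : ℕ} (hc : c < τ.m k)
    (hcb : E ξ k c = ω * ξ) (hcr : c < τ.r (k + 1))
    (hpc : ∀ s < τ.m k, E ξ k s = E ξ (k + 1) (τ.shift k i s)) : i = 0 := by
  have hb : ∀ ζ < ξ, IsChain τ E ζ := fun ζ hζ => h ζ hζ.le
  have hM := fun k => ((h ξ le_rfl).strictMonoOn (Lev.lt hb) (Lev.strictMonoOn hb) k).injOn
  have hr := τ.r_lt_m k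
  have hmm := m_lt_m_succ (τ := τ) k
  obtain ⟨a, ha, h1, -⟩ := (h ξ le_rfl).valid k
  obtain ⟨a', ha', h1', -⟩ := (h ξ le_rfl).valid (k + 1)
  obtain rfl : a = c := hM k ha hc (by rw [hcb, h1 a le_rfl]; simp)
  obtain rfl : a' = a := hM (k + 1) ha' (Set.mem_Iio.2 (by omega)) (by
    rw [← shift_of_lt (τ := τ) (i := i) hcr, ← hpc a hc, hcb, h1' a' le_rfl]; simp)
  have e := hpc (τ.m k - 1) (by omega)
  have hle := le_shift (τ := τ) (k := k) (i := i) (s := τ.m k - 1)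
  rw [h1 _ (by omega), h1' _ (by omega), add_right_inj, Nat.cast_inj,
    shift_of_le (by omega)] at e
  rcases Nat.eq_zero_or_pos i with h | h
  · exact h
  · have := Nat.mul_pos h (Nat.sub_pos_of_lt hr)
    omega

/-- A path can be continued so as to follow one of the earlier chains. -/
theorem Path.track (hE : ∀ η < ξ, IsChain τ E η) {γ₀ : Ordinal.{0}} (hγ₀ : γ₀ < ξ)
    (hp : Path τ (Lev τ E ξ) (ω * ξ) k e) (B : Finset Ordinal.{0}) (hB : ∀ x ∈ B, x < ω * ξ)
    (N : ℕ) :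
    ∃ γ < ξ, γ₀ ≤ γ ∧ ∃ u ≥ N, k ≤ u ∧ (∀ l ≥ u, ∀ x ∈ B, ∃ s < τ.m l, E γ l s = x) ∧
      ∃ e' a, Path τ (Lev τ E ξ) (ω * ξ) u e' ∧ (∀ j ≤ k, e' j = e j) ∧
        State τ (Lev τ E ξ) (ω * ξ) u (e' u) a ∧ ∀ s < a, e' u s = E γ u s := by
  obtain ⟨a, hs⟩ := hp.state k le_rfl
  obtain ⟨f, hf, hef⟩ := hs.base
  -- All m_k values of f are included, not only the old ones, so that f itself becomes an iterated
  -- piece of `E γ u`.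
  obtain ⟨γ₁, hγ₁, hlt⟩ := exists_forall_lt_mul_succ (bot_le.trans_lt hγ₀)
    (B ∪ (Finset.range (τ.m k)).image f) (by
      intro x hx
      rcases Finset.mem_union.1 hx with hx | hx
      · exact hB x hx
      · obtain ⟨s, hs, rfl⟩ := Finset.mem_image.1 hx
        exact Lev.lt hE k f hf s (Finset.mem_range.1 hs))
  have hγ : max γ₀ γ₁ < ξ := max_lt hγ₀ hγ₁
  obtain ⟨u, hu, hmem⟩ := (hE _ hγ).exists_forall_mem _ (fun x hx => (hlt x hx).trans_le
    (mul_le_mul_right (add_le_add_left (le_max_right γ₀ γ₁) 1) _)) (max N k)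
  have hku : k ≤ u := (le_max_right _ _).trans hu
  obtain ⟨σ, hσ, hfσ⟩ := Lev.exists_subEmb hE hf (Lev.mem hγ u) hku fun s hs =>
    hmem u le_rfl (f s) (Finset.mem_union_right _
      (Finset.mem_image_of_mem _ (Finset.mem_range.2 hs)))
  obtain ⟨e', a', hp', hag, hs', he'⟩ := hp.follow Lev.piece hs hσ (Lev.mem hγ u)
    fun s hsa => by rw [hef s hsa, hfσ s (hsa.trans hs.lt)]
  exact ⟨_, hγ, le_max_left _ _, u, (le_max_left _ _).trans hu, hku,
    fun l hl x hx => hmem l hl x (Finset.mem_union_left _ hx), e', a', hp', hag, hs', he'⟩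

theorem Path.follow_chain (hE : ∀ η < ξ, IsChain τ E η) (hγ : γ < ξ)
    (hp : Path τ (Lev τ E ξ) (ω * ξ) k e) (hs : State τ (Lev τ E ξ) (ω * ξ) k (e k) a)
    (he : ∀ s < a, e k s = E γ k s) (hkv : k ≤ v) :
    ∃ e' a', Path τ (Lev τ E ξ) (ω * ξ) v e' ∧ (∀ j ≤ k, e' j = e j) ∧
      State τ (Lev τ E ξ) (ω * ξ) v (e' v) a' ∧ ∀ s < a', e' v s = E γ v s := by
  obtain ⟨σ, hσ, hE'⟩ := (hE γ hγ).exists_subEmb hkv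
  exact hp.follow Lev.piece hs hσ (Lev.mem hγ v)
    fun s hsa => by rw [he s hsa, hE' s (hsa.trans hs.lt)]

/-- A path can be continued to the end of an idle interval of an earlier chain. -/
theorem Path.exists_idle (hE : ∀ η < ξ, Stage τ Pf S E η) {γ₀ : Ordinal.{0}} (hγ₀ : γ₀ < ξ)
    (hp : Path τ (Lev τ E ξ) (ω * ξ) k e) (B : Finset Ordinal.{0}) (hB : ∀ x ∈ B, x < ω * ξ)
    (p N : ℕ) :
    ∃ γ < ξ, γ₀ ≤ γ ∧ ∃ u ≥ N, k ≤ u ∧ (∀ l ≥ u, ∀ x ∈ B, ∃ s < τ.m l, E γ l s = x) ∧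
      ∃ v ≥ u + N, Idle τ (Pf p) (E γ) u v ∧
      ∃ e' a, Path τ (Lev τ E ξ) (ω * ξ) u e' ∧ (∀ j ≤ k, e' j = e j) ∧
        State τ (Lev τ E ξ) (ω * ξ) u (e' u) a ∧ ∀ s < a, e' u s = E γ u s := by
  have hE' : ∀ η < ξ, IsChain τ E η := fun η hη => (hE η hη).toIsChain
  obtain ⟨γ, hγ, hγγ, u, hu, hku, hmem, e₁, a₁, hp₁, hag₁, hs₁, he₁⟩ := hp.track hE' hγ₀ B hB N
  obtain ⟨u', hu', v, hv, hidle⟩ := (hE γ hγ).idle p u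
  obtain ⟨e₂, a₂, hp₂, hag₂, hs₂, he₂⟩ := hp₁.follow_chain hE' hγ hs₁ he₁ hu'
  exact ⟨γ, hγ, hγγ, u', hu.trans hu', hku.trans hu', fun l hl => hmem l (hu'.trans hl), v,
    by omega, hidle, e₂, a₂, hp₂, fun j hj => (hag₂ j (hj.trans hku)).trans (hag₁ j hj), hs₂, he₂⟩

/-- A path can be continued so as to absorb a given finite set and to follow an earlier chain `E γ`
in a position where it already contains `ω * γ`. -/
theorem Path.attach (hE : ∀ η < ξ, Stage τ Pf S E η) {γ₀ : Ordinal.{0}} (hγ₀ : γ₀ < ξ)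
    (hp : Path τ (Lev τ E ξ) (ω * ξ) k e) (B : Finset Ordinal.{0}) (hB : ∀ x ∈ B, x < ω * ξ)
    (N : ℕ) :
    ∃ γ < ξ, γ₀ ≤ γ ∧ ∃ u > N, k < u ∧
      ∃ e' a c, Path τ (Lev τ E ξ) (ω * ξ) u e' ∧ (∀ j ≤ k, e' j = e j) ∧
        State τ (Lev τ E ξ) (ω * ξ) u (e' u) a ∧ (∀ s < a, e' u s = E γ u s) ∧
        (c < a ∧ E γ u c = ω * γ) ∧ ∀ x ∈ B, ∃ s < τ.m u, e' u s = x := by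
  obtain ⟨γ, hγ, hγγ, u, hu, hku, hmem, v, hv, ⟨hc, hidle⟩, e₁, a, hp₁, hag₁, hs₁, he₁⟩ :=
    hp.exists_idle hE hγ₀ B hB 0 N
  -- The idle interval contains a level whose root size is exactly the number a of old elements.
  obtain ⟨l, -, hul, hlv, hra⟩ := hc a hs₁.lt.le
  obtain ⟨l, rfl⟩ : ∃ l', l = l' + 1 := ⟨l - 1, by omega⟩
  obtain ⟨e₂, hp₂, hag₂, hs₂, he₂, -⟩ := hp₁.idle hs₁ (Lev.mem hγ) he₁ (Nat.lt_succ_iff.1 hul)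
    fun j h h' => hidle j h (by omega)
  have hn := τ.two_le_n l
  have hul' : u ≤ l := Nat.lt_succ_iff.1 hul
  have hEl := hidle l hul' (by omega)
  -- As r = a, the current set can become piece 1 above `E γ l`, which by idleness is piece 0 of `E
  -- γ (l + 1)`. The old part grows to m_l elements and now contains ω·γ and B.
  obtain ⟨e₃, hp₃, hag₃, hs₃, he₃, -⟩ := hp₂.move (i := 1) hs₂ (Lev.mem hγ (l + 1)) (by omega)
    (Or.inr hra.le) (fun s hs => by
      rw [shift_of_lt (by omega), he₂ s hs, hEl s (hs.trans hs₂.lt)])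
  have ha : a + 1 * (τ.m l - τ.r (l + 1)) = τ.m l := by
    have := hs₂.lt
    omega
  rw [ha] at hs₃ he₃
  obtain ⟨c, hcl, hcv, -⟩ := (hE γ hγ).valid l
  refine ⟨γ, hγ, hγγ, l + 1, by omega, by omega, e₃, τ.m l, c, hp₃, fun j hj => ?_, hs₃, he₃,
    ⟨hcl, ?_⟩, fun x hx => ?_⟩
  · rw [hag₃ j (by omega), hag₂ j (by omega), hag₁ j hj]
  · rw [← hEl c hcl, hcv c le_rfl]; simp
  · obtain ⟨s, hs, rfl⟩ := hmem l hul' x hx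
    exact ⟨s, hs.trans (m_lt_m_succ l), by rw [he₃ s hs, hEl s hs]⟩

/-- A path attached to an earlier chain can copy it up to any level. -/
theorem Path.copy (hE : ∀ η < ξ, IsChain τ E η) (hγ : γ < ξ) {c : ℕ}
    (hp : Path τ (Lev τ E ξ) (ω * ξ) k e) (hs : State τ (Lev τ E ξ) (ω * ξ) k (e k) a)
    (he : ∀ s < a, e k s = E γ k s) (hc : c < a ∧ E γ k c = ω * γ) (hkv : k ≤ v) :
    ∃ e', Path τ (Lev τ E ξ) (ω * ξ) v e' ∧ (∀ j ≤ k, e' j = e j) ∧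
      (∀ j, k ≤ j → j < v → ∀ i < τ.n (j + 1),
        (∀ s < τ.m j, E γ j s = E γ (j + 1) (τ.shift j i s)) →
          ∀ s < τ.m j, e' j s = e' (j + 1) (τ.shift j i s)) := by
  suffices ∃ e' a' c', Path τ (Lev τ E ξ) (ω * ξ) v e' ∧ (∀ j ≤ k, e' j = e j) ∧
      State τ (Lev τ E ξ) (ω * ξ) v (e' v) a' ∧ (∀ s < a', e' v s = E γ v s) ∧
      (c' < a' ∧ E γ v c' = ω * γ) ∧
      (∀ j, k ≤ j → j < v → ∀ i < τ.n (j + 1),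
        (∀ s < τ.m j, E γ j s = E γ (j + 1) (τ.shift j i s)) →
          ∀ s < τ.m j, e' j s = e' (j + 1) (τ.shift j i s)) by
    obtain ⟨e', -, -, h1, h2, -, -, -, h3⟩ := this
    exact ⟨e', h1, h2, h3⟩
  induction v, hkv using Nat.le_induction with
  | base => exact ⟨e, a, c, hp, fun _ _ => rfl, hs, he, hc, fun j h h' => by omega⟩
  | succ v hkv ih =>
    obtain ⟨e₁, a₁, c₁, hp₁, hag₁, hs₁, he₁, ⟨hca, hcE⟩, htr⟩ := ih
    obtain ⟨i, hi, hpc⟩ := (hE γ hγ).chain v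
    have hcm := hca.trans hs₁.lt
    have hle : ∀ η ≤ γ, IsChain τ E η := fun η hη => hE η (hη.trans_lt hγ)
    -- A root longer than the old part would contain ω·γ, and in that case the chain itself uses
    -- index 0.
    have hia : i = 0 ∨ τ.r (v + 1) ≤ a₁ := by
      by_cases hcr : c₁ < τ.r (v + 1)
      · exact Or.inl (IsChain.shift_eq_zero hle hcm hcE hcr hpc)
      · right; omega
    obtain ⟨e₂, hp₂, hag₂, hs₂, he₂, hpc₂⟩ := hp₁.move hs₁ (Lev.mem hγ (v + 1)) hi hia
      fun s hs => by rw [he₁ s hs, hpc s (hs.trans hs₁.lt)]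
    refine ⟨e₂, _, τ.shift v i c₁, hp₂, fun j hj => (hag₂ j (hj.trans hkv)).trans (hag₁ j hj),
      hs₂, he₂, ⟨?_, by rw [← hpc c₁ hcm, hcE]⟩, ?_⟩
    · unfold SchemeType.shift; split_ifs <;> omega
    · intro j hj hjv i' hi' hpc'
      rcases (Nat.lt_succ_iff.1 hjv).eq_or_lt with rfl | hjv
      -- The last element of a piece is outside the root, so its position determines the index and
      -- i' = i.
      · have hr := τ.r_lt_m j
        have hlt : τ.m j - 1 < τ.m j := by omega
        have hinj := (Lev.strictMonoOn hE (j + 1) _ (Lev.mem hγ (j + 1))).injOn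
          (shift_lt hlt hi) (shift_lt hlt hi') ((hpc _ hlt).symm.trans (hpc' _ hlt))
        rcases (shift_eq_shift hlt hlt hinj).2 with rfl | h
        · exact hpc₂
        · omega
      · rw [hag₂ j hjv.le, hag₂ (j + 1) hjv]
        exact htr j hj hjv i' hi' hpc'

/-- Equal piece indices give one map of positions valid for both sequences, which transports sets of
positions from `E γ` to e. -/
theorem exists_common_subEmb (hγ : IsChain τ E γ) {u : ℕ} (huv : u ≤ k) (hkv : k ≤ v)
    (h : ∀ j, u ≤ j → j < v → ∀ i < τ.n (j + 1),
      (∀ s < τ.m j, E γ j s = E γ (j + 1) (τ.shift j i s)) →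
        ∀ s < τ.m j, e j s = e (j + 1) (τ.shift j i s)) :
    ∃ σ, SubEmb τ u k σ ∧ (∀ s < τ.m u, E γ u s = E γ k (σ s)) ∧
      ∀ s < τ.m u, e u s = e k (σ s) := by
  induction k, huv using Nat.le_induction with
  | base => exact ⟨id, .refl, fun _ _ => rfl, fun _ _ => rfl⟩
  | succ k huk ih =>
    obtain ⟨σ, hσ, h1, h2⟩ := ih (by omega)
    obtain ⟨i, hi, hi'⟩ := hγ.chain k
    refine ⟨_, hσ.step hi, fun s hs => ?_, fun s hs => ?_⟩
    · rw [h1 s hs, hi' _ (hσ.lt hs)]; rfl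
    · rw [h2 s hs, h k huk (by omega) i hi hi' _ (hσ.lt hs)]; rfl

end Stage

/-! ### One step of the recursion -/

/-- A sequence meeting countably many requirements, each of which can be secured by a finite
extension. -/
theorem exists_generic {β ι : Type*} [Countable ι] [Nonempty ι] {V : ℕ → (ℕ → β) → Prop}
    {R : ι → (ℕ → β) → Prop} {e₀ : ℕ → β} (h₀ : V 0 e₀)
    (hR : ∀ i k e, V k e → ∃ k' > k, ∃ e', V k' e' ∧ (∀ j ≤ k, e' j = e j) ∧
      ∀ e'', (∀ j ≤ k', e'' j = e' j) → R i e'') :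
    ∃ e, (∀ i, R i e) ∧ ∀ k, ∃ k' ≥ k, ∃ e', V k' e' ∧ ∀ j ≤ k', e j = e' j := by
  obtain ⟨g, hg⟩ := exists_surjective_nat ι
  choose K hK F hF hag hreq using hR
  let q : ℕ → {x : ℕ × (ℕ → β) // V x.1 x.2} := fun n => Nat.rec ⟨(0, e₀), h₀⟩
    (fun n x => ⟨(K (g n) x.1.1 x.1.2 x.2, F (g n) x.1.1 x.1.2 x.2), hF _ _ _ x.2⟩) n
  have hlt : ∀ n, (q n).1.1 < (q (n + 1)).1.1 := fun n => hK (g n) _ _ (q n).2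
  have hle : ∀ n, n ≤ (q n).1.1 := fun n => (strictMono_nat_of_lt_succ hlt).le_apply
  have hagree : ∀ n n', n ≤ n' → ∀ j ≤ (q n).1.1, (q n').1.2 j = (q n).1.2 j := by
    intro n n' h
    induction n', h using Nat.le_induction with
    | base => exact fun _ _ => rfl
    | succ n' h ih =>
      intro j hj
      exact (hag (g n') _ _ (q n').2 j
        (hj.trans ((strictMono_nat_of_lt_succ hlt).monotone h))).trans (ih j hj)
  have hlim : ∀ n, ∀ j ≤ (q n).1.1, (q j).1.2 j = (q n).1.2 j := by
    intro n j hj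
    rw [← hagree j (max j n) (le_max_left _ _) j (hle j), hagree n _ (le_max_right _ _) j hj]
  refine ⟨fun j => (q j).1.2 j, fun i => ?_, fun k => ⟨(q k).1.1, hle k, _, (q k).2, hlim k⟩⟩
  obtain ⟨n, rfl⟩ := hg i
  exact hreq (g n) _ _ (q n).2 _ (hlim (n + 1))

section Step

variable {τ : SchemeType} {Pf : ℕ → Set ℕ} {S : Ordinal.{0} → Set (Finset Ordinal.{0})}
  {E : Ordinal.{0} → ℕ → ℕ → Ordinal.{0}} {ξ : Ordinal.{0}} {k : ℕ}
  {e : ℕ → ℕ → Ordinal.{0}}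

/-! ### Securing the requirements by finite extensions -/

theorem Path.secure_cover (hE : ∀ η < ξ, Stage τ Pf S E η) (hξ : 0 < ξ)
    (hp : Path τ (Lev τ E ξ) (ω * ξ) k e) {x : Ordinal.{0}} (hx : x < ω * ξ) :
    ∃ k' > k, ∃ e', Path τ (Lev τ E ξ) (ω * ξ) k' e' ∧ (∀ j ≤ k, e' j = e j) ∧
      ∀ e'' : ℕ → ℕ → Ordinal.{0}, (∀ j ≤ k', e'' j = e' j) →
        ∃ l, ∃ s < τ.m l, e'' l s = x := by
  obtain ⟨-, -, -, u, -, hku, e', -, -, hp', hag, -, -, -, hB⟩ := hp.attach hE hξ {x} (by simpa) 0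
  obtain ⟨s, hs, hsx⟩ := hB x (by simp)
  exact ⟨u, hku, e', hp', hag, fun e'' h => ⟨u, s, hs, by rw [h u le_rfl, hsx]⟩⟩

theorem Path.secure_idle (hE : ∀ η < ξ, Stage τ Pf S E η) (hξ : 0 < ξ)
    (hp : Path τ (Lev τ E ξ) (ω * ξ) k e) (p N : ℕ) :
    ∃ k' > k, ∃ e', Path τ (Lev τ E ξ) (ω * ξ) k' e' ∧ (∀ j ≤ k, e' j = e j) ∧
      ∀ e'', (∀ j ≤ k', e'' j = e' j) → ∃ u ≥ N, ∃ v ≥ u + N, Idle τ (Pf p) e'' u v := by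
  obtain ⟨γ, hγ, -, u, hu, hku, -, v, hv, ⟨hc, hidle⟩, e₁, a, hp₁, hag₁, hs₁, he₁⟩ :=
    hp.exists_idle hE hξ ∅ (by simp) p (max N (k + 1))
  have hN := le_max_left N (k + 1)
  have hk := le_max_right N (k + 1)
  obtain ⟨e₂, hp₂, hag₂, -, -, hi₂⟩ := hp₁.idle hs₁ (Lev.mem hγ) he₁ (by omega : u ≤ v) hidle
  refine ⟨v, by omega, e₂, hp₂, fun j hj => (hag₂ j (hj.trans hku)).trans (hag₁ j hj),
    fun e'' h => ⟨u, by omega, v, by omega, hc, fun j hj hjv => ?_⟩⟩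
  rw [h j hjv.le, h (j + 1) hjv]
  exact hi₂ j hj hjv

/-- Once the path contains ω·γ with γ ≥ η, it repeats the piece indices of `E γ`, so the service of
η by `E γ` carries over. -/
theorem Path.secure_earlier (hE : ∀ η < ξ, Stage τ Pf S E η)
    (hp : Path τ (Lev τ E ξ) (ω * ξ) k e) {η : Ordinal.{0}} (hη : 0 < η) (hηξ : η < ξ)
    {k₀ : ℕ} {t₀ : Finset ℕ} (ht₀ : ∀ s ∈ t₀, s < τ.m k₀) (p N : ℕ) :
    ∃ k' > k, ∃ e', Path τ (Lev τ E ξ) (ω * ξ) k' e' ∧ (∀ j ≤ k, e' j = e j) ∧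
      ∀ e'', (∀ j ≤ k', e'' j = e' j) →
        Serves τ (Act τ (Lev τ E η) (S η) (ω * η) (E η)) (Pf p) e'' k₀ t₀ N := by
  have hE' : ∀ η < ξ, IsChain τ E η := fun η hη => (hE η hη).toIsChain
  obtain ⟨γ, hγ, hηγ, u, hu, hku, e₁, a, c, hp₁, hag₁, hs₁, he₁, hc₁, -⟩ :=
    hp.attach hE hηξ ∅ (by simp) k₀
  obtain ⟨σ, hσ, hσe⟩ := hp₁.exists_subEmb hu.le
  have ht : ∀ s ∈ t₀.image σ, s < τ.m u := by
    intro s hs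
    obtain ⟨s', hs', rfl⟩ := Finset.mem_image.1 hs
    exact hσ.lt (ht₀ s' hs')
  obtain ⟨l, hul, hNl, hlP, j, t, htl, hact, hpc, himg⟩ :=
    (hE γ hγ).act η hη hηγ u (t₀.image σ) ht p N
  obtain ⟨e₂, hp₂, hag₂, htr⟩ := hp₁.copy hE' hγ hs₁ he₁ hc₁ (by omega : u ≤ l + 1)
  obtain ⟨θ, hθ, hθγ, hθe⟩ := exists_common_subEmb (hE' γ hγ) hul (Nat.le_succ l) htr
  have htθ : t = (t₀.image σ).image θ := by
    have hinj := (Lev.strictMonoOn hE' l _ (Lev.mem hγ l)).injOn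
    have h1 : t.image (E γ l) = ((t₀.image σ).image θ).image (E γ l) := by
      rw [himg, Finset.image_image (s := t₀.image σ)]
      exact Finset.image_congr fun s hs => hθγ s (ht s hs)
    have h2 : (t : Set ℕ) ⊆ Set.Iio (τ.m l) := fun s hs => htl s hs
    have h3 : (((t₀.image σ).image θ : Finset ℕ) : Set ℕ) ⊆ Set.Iio (τ.m l) := by
      intro s hs
      obtain ⟨s', hs', rfl⟩ := Finset.mem_image.1 hs
      exact hθ.lt (ht s' hs')
    apply Finset.coe_injective
    apply (hinj.image_eq_image_iff h2 h3).1
    simpa only [Finset.coe_image] using congrArg (fun x : Finset Ordinal.{0} => (x : Set Ordinal.{0})) h1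
  refine ⟨l + 1, by omega, e₂, hp₂, fun i hi => (hag₂ i (hi.trans hku.le)).trans (hag₁ i hi),
    fun e'' h => ⟨l, by omega, hNl, hlP, j, t, htl, hact, ?_, ?_⟩⟩
  · rw [h l (Nat.le_succ l), h (l + 1) le_rfl]
    exact htr l hul (Nat.lt_succ_self l) j hact.lt hpc
  · rw [h l (Nat.le_succ l), h k₀ (by omega), htθ, hag₂ k₀ hu.le, Finset.image_image,
      Finset.image_image]
    refine Finset.image_congr fun s hs => ?_
    have hs' := ht₀ s hs
    simp only [Function.comp]
    rw [← hθe _ (hσ.lt hs'), hag₂ u le_rfl, hσe s hs']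

/-- Inside an idle interval of an earlier chain there is a level in P whose root size is the number
of old elements. There ω·ξ comes right after the root, and the greedy choice can be made. -/
theorem Path.secure_self (hE : ∀ η < ξ, Stage τ Pf S E η) (hξ : 0 < ξ)
    (hp : Path τ (Lev τ E ξ) (ω * ξ) k e)
    {k₀ : ℕ} {t₀ : Finset ℕ} (ht₀ : ∀ s ∈ t₀, s < τ.m k₀) (p N : ℕ) :
    ∃ k' > k, ∃ e', Path τ (Lev τ E ξ) (ω * ξ) k' e' ∧ (∀ j ≤ k, e' j = e j) ∧
      ∀ e'', (∀ j ≤ k', e'' j = e' j) →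
        Serves τ (Act τ (Lev τ E ξ) (S ξ) (ω * ξ) e'') (Pf p) e'' k₀ t₀ N := by
  classical
  obtain ⟨γ, hγ, -, u, hu, hku, -, v, hv, ⟨hc, hidle⟩, e₁, a, hp₁, hag₁, hs₁, he₁⟩ :=
    hp.exists_idle hE hξ ∅ (by simp) p (max N k₀)
  have hN := le_max_left N k₀
  have hk := le_max_right N k₀
  obtain ⟨l, hlP, hul, hlv, rfl⟩ := hc a hs₁.lt.le
  obtain ⟨l, rfl⟩ : ∃ l', l = l' + 1 := ⟨l - 1, by omega⟩
  have hul' : u ≤ l := Nat.lt_succ_iff.1 hul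
  obtain ⟨e₂, hp₂, hag₂, hs₂, he₂, -⟩ := hp₁.idle hs₁ (Lev.mem hγ) he₁ hul'
    fun j h h' => hidle j h (by omega)
  obtain ⟨σ, hσ, hσe⟩ := hp₂.exists_subEmb (by omega : k₀ ≤ l)
  have hn := τ.two_le_n l
  have ht : ∀ s ∈ t₀.image σ, s < τ.m l := by
    intro s hs
    obtain ⟨s', hs', rfl⟩ := Finset.mem_image.1 hs
    exact hσ.lt (ht₀ s' hs')
  set t := t₀.image σ with ht_def
  let Q : ℕ → Prop := fun j => ∃ H ∈ Lev τ E ξ (l + 1), (∀ s < τ.r (l + 1), H s = e₂ l s) ∧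
    ∀ i < j, t.image (fun s => H (τ.shift l i s)) ∈ S ξ
  -- Idleness makes `E γ (l + 1)` a set with the required root.
  have hQ : Q 0 := ⟨E γ (l + 1), Lev.mem hγ _, fun s hs => by
    rw [he₂ s hs, hidle l hul' (by omega) s (hs.trans hs₂.lt)], fun i hi => by omega⟩
  -- The bound n - 1 reserves one piece, the one of index j, for the path itself.
  obtain ⟨H, hH, hHr, hHS⟩ := Nat.findGreatest_spec (Nat.zero_le (τ.n (l + 1) - 1)) hQ
  have hmax : ∀ j' < τ.n (l + 1), Q j' → j' ≤ Nat.findGreatest Q (τ.n (l + 1) - 1) :=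
    fun j' hj' h => Nat.le_findGreatest (by omega) h
  have hj : Nat.findGreatest Q (τ.n (l + 1) - 1) < τ.n (l + 1) :=
    (Nat.findGreatest_le _).trans_lt (by omega)
  set j := Nat.findGreatest Q (τ.n (l + 1) - 1)
  obtain ⟨e₃, hp₃, hag₃, hs₃, he₃, hpc⟩ := hp₂.move hs₂ hH hj (Or.inr le_rfl)
    (fun s hs => by rw [shift_of_lt hs, hHr s hs])
  have hl := hag₃ l le_rfl
  refine ⟨l + 1, by omega, e₃, hp₃, fun i hi => ?_, fun e'' h => ⟨l, by omega, by omega, hlP, j, t,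
    ht, ⟨hj, ?_, ?_, fun i hi => ?_, fun j' hj' H' hH' hHr' hHS' => hmax j' hj' ⟨H', hH', ?_, hHS'⟩⟩,
    ?_, ?_⟩⟩
  · rw [hag₃ i (by omega), hag₂ i (by omega), hag₁ i hi]
  · rw [h l (Nat.le_succ l), hl, hs₂.tail _ le_rfl]; simp
  · rw [h l (Nat.le_succ l), h (l + 1) le_rfl]; exact hpc
  · rw [h (l + 1) le_rfl]
    convert hHS i hi using 1
    exact Finset.image_congr fun s hs => he₃ _ (shift_lt_of_lt (ht s hs) hi)
  · rw [h l (Nat.le_succ l), hl] at hHr'; exact hHr'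
  · rw [h l (Nat.le_succ l), h (l + 1) le_rfl]; exact hpc
  · rw [h l (Nat.le_succ l), h k₀ (by omega), hl, hag₃ k₀ (by omega), ht_def, Finset.image_image]
    exact Finset.image_congr fun s hs => (hσe s (ht₀ s hs)).symm

theorem IsChain.congr {E' : Ordinal.{0} → ℕ → ℕ → Ordinal.{0}} (h : ∀ η ≤ ξ, E η = E' η)
    (hE : IsChain τ E ξ) : IsChain τ E' ξ := by
  obtain ⟨h1, h2, h3⟩ := hE
  rw [h ξ le_rfl] at h1 h2 h3
  rw [Lev.congr fun η hη => h η hη.le] at h1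
  exact ⟨h1, h2, h3⟩

theorem Stage.congr {E' : Ordinal.{0} → ℕ → ℕ → Ordinal.{0}} (h : ∀ η ≤ ξ, E η = E' η)
    (hE : Stage τ Pf S E ξ) : Stage τ Pf S E' ξ := by
  refine ⟨hE.toIsChain.congr h, ?_, fun η hη hηξ => ?_⟩
  · rw [← h ξ le_rfl]; exact hE.idle
  · rw [← h ξ le_rfl, ← h η hηξ, ← Lev.congr fun ζ hζ => h ζ (hζ.le.trans hηξ)]
    exact hE.act η hη hηξ

theorem countable_Iio_of_lt {α : Ordinal.{0}} (h : α < ω₁) : (Set.Iio α).Countable := by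
  rw [← Cardinal.le_aleph0_iff_set_countable, Cardinal.mk_Iio_ordinal, Cardinal.lift_le_aleph0]
  rw [← Cardinal.ord_aleph, Cardinal.lt_ord, ← Cardinal.succ_aleph0, Order.lt_succ_iff] at h
  exact h

theorem omega_mul_lt_omega_one (h : ξ < ω₁) : ω * ξ < ω₁ :=
  (isPrincipal_mul_omega 1) omega0_lt_omega_one h

theorem exists_idle_bound (hcomp : ∀ p c : ℕ, {l | l ∈ Pf p ∧ τ.r l = c}.Infinite) (p u : ℕ) :
    ∃ v₀, ∀ v ≥ v₀, ∀ c ≤ τ.m u, ∃ l ∈ Pf p, u < l ∧ l ≤ v ∧ τ.r l = c := by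
  choose g hg hug using fun c => (hcomp p c).exists_gt u
  refine ⟨(Finset.range (τ.m u + 1)).sup g, fun v hv c hc => ⟨g c, (hg c).1, hug c, ?_, (hg c).2⟩⟩
  exact (Finset.le_sup (Finset.mem_range.2 (by omega))).trans hv

theorem stage_zero (hcomp : ∀ p c : ℕ, {l | l ∈ Pf p ∧ τ.r l = c}.Infinite)
    (h : ∀ k s, E 0 k s = (s : Ordinal.{0})) : Stage τ Pf S E 0 := by
  refine ⟨⟨fun k => ⟨0, m_pos k, fun s _ => by simp [h], by simp⟩, fun k => ⟨0, ?_, ?_⟩, ?_⟩, ?_, ?_⟩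
  · have := τ.two_le_n k; omega
  · simp [h]
  · intro x hx
    rw [zero_add, mul_one] at hx
    obtain ⟨n, rfl⟩ := lt_omega0.1 hx
    refine ⟨n, n, ?_, h n n⟩
    have := m_add_le (τ := τ) 0 n
    have := m_pos (τ := τ) 0
    rw [zero_add] at *
    omega
  · intro p N
    obtain ⟨v, hv⟩ := exists_idle_bound hcomp p N
    exact ⟨N, le_rfl, max v (N + N), le_max_right _ _, hv _ (le_max_left _ _), by simp [h]⟩
  · intro η hη hη0
    exact absurd hη0 (not_le.2 hη)

theorem exists_stage (hE : ∀ η < ξ, Stage τ Pf S E η) (hξ : 0 < ξ) (hξ' : ξ < ω₁) :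
    ∃ e, Stage τ Pf S (Function.update E ξ e) ξ := by
  have : Countable (Set.Iio (ω * ξ)) := (countable_Iio_of_lt (omega_mul_lt_omega_one hξ')).to_subtype
  have : Countable (Set.Iio ξ) := (countable_Iio_of_lt hξ').to_subtype
  have : Nonempty (Set.Iio (ω * ξ)) := ⟨⟨0, mul_pos omega0_pos hξ⟩⟩
  -- The requirements are: covering ordinals below ω·ξ, idle intervals, sealing for earlier η, and
  -- sealing for ξ itself. They are countably many because ξ < ω₁; the bound N is part of the index,
  -- so meeting each once is enough.
  obtain ⟨e, hR, hV⟩ := exists_generic (V := Path τ (Lev τ E ξ) (ω * ξ))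
    (ι := Set.Iio (ω * ξ) ⊕ (ℕ × ℕ) ⊕ (Set.Iio ξ × ℕ × Finset ℕ × ℕ × ℕ) ⊕ (ℕ × Finset ℕ × ℕ × ℕ))
    (R := Sum.elim (fun x e => ∃ l, ∃ s < τ.m l, e l s = x) <|
      Sum.elim (fun x e => ∃ u ≥ x.2, ∃ v ≥ u + x.2, Idle τ (Pf x.1) e u v) <|
      Sum.elim (fun x e => 0 < x.1.1 → (∀ s ∈ x.2.2.1, s < τ.m x.2.1) →
        Serves τ (Act τ (Lev τ E x.1) (S x.1) (ω * x.1) (E x.1)) (Pf x.2.2.2.1) e x.2.1 x.2.2.1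
          x.2.2.2.2)
        (fun x e => (∀ s ∈ x.2.1, s < τ.m x.1) →
          Serves τ (Act τ (Lev τ E ξ) (S ξ) (ω * ξ) e) (Pf x.2.2.1) e x.1 x.2.1 x.2.2.2))
    (e₀ := fun _ s => ω * ξ + (s : Ordinal.{0}))
    ⟨fun j hj => ⟨0, m_pos j, by simp, E 0 j, Lev.mem hξ j, by simp⟩, by simp⟩ (by
      rintro (⟨x, hx⟩ | ⟨p, N⟩ | ⟨⟨η, hη⟩, k₀, t₀, p, N⟩ | ⟨k₀, t₀, p, N⟩) k e hp
      · exact hp.secure_cover hE hξ hx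
      · exact hp.secure_idle hE hξ p N
      · by_cases h : 0 < η ∧ ∀ s ∈ t₀, s < τ.m k₀
        · obtain ⟨k', hk, e', h1, h2, h3⟩ := hp.secure_earlier hE h.1 hη h.2 p N
          exact ⟨k', hk, e', h1, h2, fun e'' h _ _ => h3 e'' h⟩
        · obtain ⟨k', hk, e', h1, h2, -⟩ := hp.secure_idle hE hξ p N
          exact ⟨k', hk, e', h1, h2, fun e'' _ h' h'' => absurd ⟨h', h''⟩ h⟩
      · by_cases h : ∀ s ∈ t₀, s < τ.m k₀
        · obtain ⟨k', hk, e', h1, h2, h3⟩ := hp.secure_self hE hξ h p N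
          exact ⟨k', hk, e', h1, h2, fun e'' h _ => h3 e'' h⟩
        · obtain ⟨k', hk, e', h1, h2, -⟩ := hp.secure_idle hE hξ p N
          exact ⟨k', hk, e', h1, h2, fun e'' _ h' => absurd h' h⟩)
  have hstate : ∀ k, ∃ a, State τ (Lev τ E ξ) (ω * ξ) k (e k) a := by
    intro k
    obtain ⟨k', hk, e', hp, hag⟩ := hV k
    rw [hag k hk]
    exact hp.state k hk
  have hLev : Lev τ (Function.update E ξ e) ξ = Lev τ E ξ :=
    Lev.congr fun η hη => Function.update_of_ne hη.ne _ _
  have hidle : ∀ p N, ∃ u ≥ N, ∃ v ≥ u + N, Idle τ (Pf p) e u v :=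
    fun p N => hR (.inr (.inl (p, N)))
  refine ⟨e, ⟨⟨fun k => ?_, fun k => ?_, fun x hx => ?_⟩, ?_, ?_⟩⟩
  · obtain ⟨a, h1, h2, h3⟩ := hstate k
    simp only [Function.update_self, hLev]
    exact ⟨a, h1, h2, fun _ => h3⟩
  · obtain ⟨k', hk, e', hp, hag⟩ := hV (k + 1)
    simp only [Function.update_self]
    rw [hag k (by omega), hag (k + 1) hk]
    exact hp.chain k hk
  · simp only [Function.update_self]
    by_cases hx' : x < ω * ξ
    · exact hR (.inl ⟨x, hx'⟩)
    · obtain ⟨y, rfl⟩ := exists_add_of_le (not_lt.1 hx')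
      rw [mul_omega_add_one, add_lt_add_iff_left] at hx
      obtain ⟨n, rfl⟩ := lt_omega0.1 hx
      -- Over an idle interval of length at least n the old part does not grow while the size
      -- increases by at least n, which makes room for ω·ξ + n.
      obtain ⟨u, -, v, hv, -, hi⟩ := hidle 0 n
      obtain ⟨a, ha⟩ := hstate u
      obtain ⟨a', ha'⟩ := hstate v
      have huv : ∀ l, u ≤ l → l ≤ v → e l a = ω * ξ := by
        intro l hul
        induction l, hul using Nat.le_induction with
        | base => intro _; rw [ha.tail a le_rfl]; simp
        | succ l hul ih =>
          intro hl
          rw [← hi l hul hl a (ha.lt.trans_le (m_strictMono.monotone hul)), ih (by omega)]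
      have haa : a' ≤ a := by
        by_contra hlt
        obtain ⟨f, hf, hf'⟩ := ha'.base
        have := Lev.lt (fun η hη => (hE η hη).toIsChain) v f hf a ((not_le.1 hlt).trans ha'.lt)
        rw [← hf' a (not_le.1 hlt), huv v (by omega) le_rfl] at this
        exact lt_irrefl _ this
      have h1 := m_add_le (τ := τ) u n
      have h2 := m_strictMono (τ := τ).monotone hv
      have h3 := ha.lt
      refine ⟨v, a' + n, by omega, ?_⟩
      rw [ha'.tail _ (by omega)]
      simp
  · simpa only [Function.update_self] using hidle
  · intro η hη hηξ k₀ t₀ ht₀ p N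
    rcases hηξ.eq_or_lt with rfl | hlt
    · rw [hLev, Function.update_self]
      exact hR (.inr (.inr (.inr (k₀, t₀, p, N)))) ht₀
    · rw [Function.update_self, Function.update_of_ne hlt.ne,
        Lev.congr fun ζ hζ => Function.update_of_ne (hζ.trans hlt).ne _ _]
      exact hR (.inr (.inr (.inl (⟨η, hlt⟩, k₀, t₀, p, N)))) hη ht₀

/-! ### The recursion of length ω₁ -/

/-- Dependent choice along a well-order. -/
theorem exists_forall_of_step {ι β : Type*} [LinearOrder ι] [WellFoundedLT ι] [Nonempty β]
    (Q : ι → (ι → β) → Prop)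
    (hcongr : ∀ ξ f g, (∀ η ≤ ξ, f η = g η) → Q ξ f → Q ξ g)
    (hstep : ∀ ξ f, (∀ η < ξ, Q η f) → ∃ b, Q ξ (Function.update f ξ b)) :
    ∃ f, ∀ ξ, Q ξ f := by
  classical
  let b₀ : β := Classical.arbitrary β
  -- The default b₀ fills the values not yet defined; by `hcongr` they do not matter.
  let G : (ξ : ι) → ((η : ι) → η < ξ → β) → ι → β :=
    fun ξ ih η => if h : η < ξ then ih η h else b₀
  let f : ι → β := (wellFounded_lt (α := ι)).fix fun ξ ih =>
    Classical.epsilon fun b => Q ξ (Function.update (G ξ ih) ξ b)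
  have hf : ∀ ξ, f ξ = Classical.epsilon fun b =>
      Q ξ (Function.update (G ξ fun η _ => f η) ξ b) := fun ξ => WellFounded.fix_eq _ _ _
  refine ⟨f, fun ξ => ?_⟩
  induction ξ using WellFoundedLT.induction with
  | _ ξ ih =>
    have hG : ∀ η < ξ, (G ξ fun η _ => f η) η = f η := fun η hη => by simp [G, hη]
    have h := Classical.epsilon_spec (hstep ξ (G ξ fun η _ => f η) fun η hη =>
      hcongr η f _ (fun ζ hζ => (hG ζ (hζ.trans_lt hη)).symm) (ih η hη))
    rw [← hf ξ] at h
    refine hcongr ξ _ _ (fun η hη => ?_) h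
    rcases hη.eq_or_lt with rfl | hη
    · simp
    · rw [Function.update_of_ne hη.ne, hG η hη]

/-- The chains exist, for arbitrary guesses `S`. -/
theorem exists_chains (τ : SchemeType) (Pf : ℕ → Set ℕ)
    (hcomp : ∀ p c : ℕ, {l | l ∈ Pf p ∧ τ.r l = c}.Infinite)
    (S : Ordinal.{0} → Set (Finset Ordinal.{0})) :
    ∃ E : Ordinal.{0} → ℕ → ℕ → Ordinal.{0}, ∀ ξ < ω₁, Stage τ Pf S E ξ := by
  refine exists_forall_of_step (fun ξ E => ξ < ω₁ → Stage τ Pf S E ξ)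
    (fun ξ f g h hf hξ => (hf hξ).congr h) fun ξ E hE => ?_
  by_cases hξ' : ξ < ω₁
  · rcases eq_or_ne ξ 0 with rfl | hξ
    · exact ⟨fun _ s => s, fun _ => stage_zero hcomp (by simp)⟩
    · obtain ⟨e, he⟩ := exists_stage (fun η hη => hE η hη (hη.trans hξ'))
        (pos_iff_ne_zero.2 hξ) hξ'
      exact ⟨e, fun _ => he⟩
  · exact ⟨fun _ s => s, fun h => absurd h hξ'⟩

end Step

/-! ### Enumerated schemes -/

/-- A construction scheme presented by enumerations of the sets of level `k`. -/
structure IsEnumeration (τ : SchemeType) (X : Set Ordinal.{0}) (L : ℕ → Set (ℕ → Ordinal.{0})) :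
    Prop where
  mem : ∀ k, ∀ f ∈ L k, ∀ s < τ.m k, f s ∈ X
  mono : ∀ k, ∀ f ∈ L k, StrictMonoOn f (Set.Iio (τ.m k))
  piece : ∀ k, ∀ f ∈ L (k + 1), ∀ i < τ.n (k + 1), f ∘ τ.shift k i ∈ L k
  coherent : ∀ k, ∀ f ∈ L k, ∀ g ∈ L k, Coherent (τ.m k) f g
  cofinal : ∀ A : Finset Ordinal.{0}, (A : Set Ordinal.{0}) ⊆ X → ∀ N, ∃ k ≥ N, ∃ f ∈ L k,
    ∀ x ∈ A, ∃ s < τ.m k, f s = x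

/-- The set enumerated by the first `m` values of `f`. -/
noncomputable def enumSet (m : ℕ) (f : ℕ → Ordinal.{0}) : Finset Ordinal.{0} := (Finset.range m).image f

theorem mem_enumSet {m : ℕ} {f : ℕ → Ordinal.{0}} {x : Ordinal.{0}} :
    x ∈ enumSet m f ↔ ∃ s < m, f s = x := by simp [enumSet]

/-- The family of sets enumerated by `L`. -/
def family (τ : SchemeType) (L : ℕ → Set (ℕ → Ordinal.{0})) : Set (Finset Ordinal.{0}) :=
  {F | ∃ k, ∃ f ∈ L k, F = enumSet (τ.m k) f}

theorem SubEmb.factor {τ : SchemeType} {k j l : ℕ} {σ : ℕ → ℕ} (h : SubEmb τ k l σ) (hkj : k ≤ j)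
    (hjl : j ≤ l) : ∃ σ₁ σ₂, SubEmb τ k j σ₁ ∧ SubEmb τ j l σ₂ ∧ σ = σ₂ ∘ σ₁ := by
  induction h with
  | refl =>
    obtain rfl : j = k := le_antisymm hjl hkj
    exact ⟨id, id, .refl, .refl, rfl⟩
  | @step l i σ h hi ih =>
    rcases hjl.eq_or_lt with rfl | hjl
    · exact ⟨_, id, h.step hi, .refl, rfl⟩
    · obtain ⟨σ₁, σ₂, h₁, h₂, rfl⟩ := ih (Nat.lt_succ_iff.1 hjl)
      exact ⟨σ₁, _, h₁, h₂.step hi, rfl⟩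

namespace IsEnumeration

variable {τ : SchemeType} {X : Set Ordinal.{0}} {L : ℕ → Set (ℕ → Ordinal.{0})}
  {k l : ℕ} {f g h : ℕ → Ordinal.{0}}

theorem card_enumSet (hL : IsEnumeration τ X L)
    (hf : f ∈ L k) : (enumSet (τ.m k) f).card = τ.m k := by
  rw [enumSet, Finset.card_image_of_injOn, Finset.card_range]
  simpa using (hL.mono k f hf).injOn

theorem comp (hL : IsEnumeration τ X L)
    (hf : f ∈ L l) {σ : ℕ → ℕ} (hσ : SubEmb τ k l σ) : f ∘ σ ∈ L k := by
  induction hσ generalizing f with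
  | refl => exact hf
  | step _ hi ih => exact ih (hL.piece _ f hf _ hi)

/-- Cofinality at high levels gives a large set containing f; coherence places f in it as an
iterated piece, and the embedding is cut at level l. -/
theorem exists_superset (hL : IsEnumeration τ X L) (hf : f ∈ L k) (hkl : k ≤ l) :
    ∃ g ∈ L l, ∀ s < τ.m k, ∃ p < τ.m l, g p = f s := by
  have hm := τ.m_pos k
  obtain ⟨l', hl', g, hg, hmem⟩ := hL.cofinal (enumSet (τ.m k) f) (fun x hx => by
    obtain ⟨s, hs, rfl⟩ := mem_enumSet.1 hx
    exact hL.mem k f hf s hs) l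
  obtain ⟨p, hp, e⟩ := hmem _ (mem_enumSet.2 ⟨τ.m k - 1, by omega, rfl⟩)
  obtain ⟨σ, hσ, q, hq, rfl⟩ := SubEmb.exists_eq (hkl.trans hl') hp
  obtain ⟨-, h2⟩ := hL.coherent k f hf _ (hL.comp hg hσ) (τ.m k - 1) (by omega) q hq e.symm
  obtain ⟨σ₁, σ₂, h₁, h₂, rfl⟩ := hσ.factor hkl hl'
  exact ⟨_, hL.comp hg h₂, fun s hs => ⟨σ₁ s, h₁.lt hs, (h2 s (by omega)).symm⟩⟩

/-- Smaller members have smaller cardinality, hence lower level, and piece 0 is a smaller member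
exactly one level down. -/
theorem rank_eq (hL : IsEnumeration τ X L)
    (k : ℕ) : ∀ f ∈ L k, ∀ hF : enumSet (τ.m k) f ∈ family τ L,
    IsWellFounded.rank (α := family τ L) (· < ·) ⟨enumSet (τ.m k) f, hF⟩ = (k : Ordinal.{1}) := by
  induction k using Nat.strong_induction_on with
  | _ k ih =>
    intro f hf hF
    apply le_antisymm
    · rw [IsWellFounded.rank_eq]
      refine Ordinal.iSup_le ?_
      rintro ⟨⟨F, hF'⟩, hlt⟩
      obtain ⟨j, g, hg, rfl⟩ := id hF'
      have hss : enumSet (τ.m j) g ⊂ enumSet (τ.m k) f := hlt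
      have hcard := Finset.card_lt_card hss
      rw [hL.card_enumSet hg, hL.card_enumSet hf] at hcard
      have hjk := m_strictMono.lt_iff_lt.1 hcard
      rw [ih j hjk g hg hF', Order.succ_le_iff]
      exact Nat.cast_lt.2 hjk
    · cases k with
      | zero => simp
      | succ j =>
        have hn := τ.two_le_n j
        have hg := hL.piece j f hf 0 (by omega)
        have hG : enumSet (τ.m j) (f ∘ τ.shift j 0) ∈ family τ L := ⟨j, _, hg, rfl⟩
        have hss : enumSet (τ.m j) (f ∘ τ.shift j 0) ⊂ enumSet (τ.m (j + 1)) f := by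
          rw [Finset.ssubset_iff_subset_ne]
          constructor
          · intro x hx
            obtain ⟨s, hs, rfl⟩ := mem_enumSet.1 hx
            exact mem_enumSet.2 ⟨s, hs.trans (m_lt_m_succ j), by simp⟩
          · intro h
            have := congrArg Finset.card h
            rw [hL.card_enumSet hg, hL.card_enumSet hf] at this
            exact (m_lt_m_succ j).ne this
        have hlt : (⟨_, hG⟩ : family τ L) < ⟨_, hF⟩ := hss
        have := IsWellFounded.rank_lt_of_rel (r := ((· < ·) : family τ L → family τ L → Prop)) hlt
        rw [ih j (Nat.lt_succ_self j) _ hg] at this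
        rw [Nat.cast_succ, ← Order.succ_eq_add_one, Order.succ_le_iff]
        exact this

theorem mem_level (hL : IsEnumeration τ X L) {F : Finset Ordinal.{0}} :
    F ∈ level (family τ L) k ↔ ∃ f ∈ L k, F = enumSet (τ.m k) f := by
  constructor
  · rintro ⟨hF, hr⟩
    obtain ⟨j, f, hf, rfl⟩ := id hF
    rw [hL.rank_eq j f hf hF, Nat.cast_inj] at hr
    subst hr
    exact ⟨f, hf, rfl⟩
  · rintro ⟨f, hf, rfl⟩
    exact ⟨⟨k, f, hf, rfl⟩, hL.rank_eq k f hf _⟩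

theorem isDecomposition (hL : IsEnumeration τ X L) (hh : h ∈ L (k + 1)) :
    IsDecomposition τ (family τ L) k (enumSet (τ.m (k + 1)) h)
      (fun i => enumSet (τ.m k) (h ∘ τ.shift k i)) (enumSet (τ.r (k + 1)) h) := by
  have hr := τ.r_lt_m k
  have hmm := m_lt_m_succ (τ := τ) k
  have hM := hL.mono _ h hh
  have htail : ∀ {i x}, i < τ.n (k + 1) →
      x ∈ enumSet (τ.m k) (h ∘ τ.shift k i) \ enumSet (τ.r (k + 1)) h →
      ∃ s, τ.r (k + 1) ≤ s ∧ s < τ.m k ∧ h (τ.shift k i s) = x := by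
    intro i x hi hx
    rw [Finset.mem_sdiff, mem_enumSet, mem_enumSet] at hx
    obtain ⟨⟨s, hs, rfl⟩, hx⟩ := hx
    refine ⟨s, ?_, hs, rfl⟩
    by_contra hlt
    exact hx ⟨s, by omega, by rw [Function.comp, shift_of_lt (by omega)]⟩
  have hne : ∀ i < τ.n (k + 1),
      (enumSet (τ.m k) (h ∘ τ.shift k i) \ enumSet (τ.r (k + 1)) h).Nonempty := by
    intro i hi
    refine ⟨h (τ.shift k i (τ.r (k + 1))), ?_⟩
    rw [Finset.mem_sdiff, mem_enumSet, mem_enumSet]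
    refine ⟨⟨_, hr, rfl⟩, ?_⟩
    rintro ⟨s, hs, e⟩
    have := hM.injOn (Set.mem_Iio.2 (by omega)) (shift_lt hr hi) e
    have := le_shift (τ := τ) (k := k) (i := i) (s := τ.r (k + 1))
    omega
  refine ⟨fun i hi => hL.mem_level.2 ⟨_, hL.piece k h hh i hi, rfl⟩, ?_, ?_, ?_, ?_, ?_⟩
  · ext x
    simp only [mem_enumSet, Finset.mem_biUnion, Finset.mem_range]
    constructor
    · rintro ⟨s, hs, rfl⟩
      obtain ⟨i, hi, q, hq, rfl⟩ := exists_shift_eq hs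
      exact ⟨i, hi, q, hq, rfl⟩
    · rintro ⟨i, hi, q, hq, rfl⟩
      exact ⟨_, shift_lt hq hi, rfl⟩
  · intro i hi j hj hij
    ext x
    simp only [Finset.mem_inter, mem_enumSet]
    constructor
    · rintro ⟨⟨s, hs, rfl⟩, s', hs', e⟩
      obtain ⟨rfl, h | h⟩ := shift_eq_shift hs' hs
        (hM.injOn (shift_lt hs' hj) (shift_lt hs hi) e)
      · exact absurd h hij.symm
      · exact ⟨s', h, by rw [Function.comp, shift_of_lt h]⟩
    · rintro ⟨s, hs, rfl⟩
      exact ⟨⟨s, by omega, by rw [Function.comp, shift_of_lt hs]⟩,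
        s, by omega, by rw [Function.comp, shift_of_lt hs]⟩
  · rw [enumSet, Finset.card_image_of_injOn, Finset.card_range]
    exact hM.injOn.mono fun s hs => Set.mem_Iio.2 (by simp at hs; omega)
  · refine fun i hi => ⟨hne i hi, fun x hx y hy => ?_⟩
    obtain ⟨s, hs, rfl⟩ := mem_enumSet.1 hx
    obtain ⟨s', hs', hsm, rfl⟩ := htail hi hy
    have := le_shift (τ := τ) (k := k) (i := i) (s := s')
    exact hM (Set.mem_Iio.2 (by omega)) (shift_lt hsm hi) (by omega)
  · refine fun i j hij hj => ⟨hne j hj, fun x hx y hy => ?_⟩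
    obtain ⟨s, hs, hsm, rfl⟩ := htail (hij.trans hj) hx
    obtain ⟨s', hs', hsm', rfl⟩ := htail hj hy
    refine hM (shift_lt hsm (hij.trans hj)) (shift_lt hsm' hj) ?_
    have := shift_lt_of_lt hsm hij
    rw [shift_of_le (s := s') hs']
    omega

theorem isConstructionScheme (hL : IsEnumeration τ X L)
    : IsConstructionScheme τ X (family τ L) where
  subset_FIN := by
    rintro _ ⟨k, f, hf, rfl⟩
    refine ⟨⟨f 0, mem_enumSet.2 ⟨0, m_pos k, rfl⟩⟩, fun x hx => ?_⟩
    obtain ⟨s, hs, rfl⟩ := mem_enumSet.1 hx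
    exact hL.mem k f hf s hs
  cofinal := by
    intro A hA
    obtain ⟨k, -, f, hf, h⟩ := hL.cofinal A hA.2 0
    exact ⟨_, ⟨k, f, hf, rfl⟩, fun x hx => mem_enumSet.2 (h x hx)⟩
  card_eq := by
    intro k F hF
    obtain ⟨f, hf, rfl⟩ := hL.mem_level.1 hF
    exact hL.card_enumSet hf
  initSeg := by
    have key : ∀ k, ∀ f ∈ L k, ∀ g ∈ L k,
        InitSeg (enumSet (τ.m k) f ∩ enumSet (τ.m k) g) (enumSet (τ.m k) f) := by
      intro k f hf g hg
      refine ⟨Finset.inter_subset_left, fun x hx y hy hyx => ?_⟩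
      rw [Finset.mem_inter, mem_enumSet, mem_enumSet] at hx
      obtain ⟨⟨a, ha, rfl⟩, b, hb, e⟩ := hx
      obtain ⟨c, hc, rfl⟩ := mem_enumSet.1 hy
      obtain ⟨rfl, h⟩ := hL.coherent k f hf g hg a ha b hb e.symm
      rw [Finset.mem_inter, mem_enumSet, mem_enumSet]
      exact ⟨⟨c, hc, rfl⟩, c, hc, (h c ((hL.mono k f hf).lt_iff_lt hc ha |>.1 hyx).le).symm⟩
    intro k E hE F hF
    obtain ⟨f, hf, rfl⟩ := hL.mem_level.1 hE
    obtain ⟨g, hg, rfl⟩ := hL.mem_level.1 hF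
    exact ⟨key k f hf g hg, by rw [Finset.inter_comm]; exact key k g hg f hf⟩
  decomposition := by
    intro k F hF
    obtain ⟨f, hf, rfl⟩ := hL.mem_level.1 hF
    exact ⟨_, _, hL.isDecomposition hf⟩

/-! ### The metric of an enumerated scheme -/

theorem rho_le (hL : IsEnumeration τ X L)
    (hf : f ∈ L k) {a b : ℕ} (ha : a < τ.m k) (hb : b < τ.m k) :
    rho (family τ L) (f a) (f b) ≤ k :=
  Nat.sInf_le ⟨_, hL.mem_level.2 ⟨f, hf, rfl⟩, mem_enumSet.2 ⟨a, ha, rfl⟩,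
    mem_enumSet.2 ⟨b, hb, rfl⟩⟩

theorem exists_of_rho_le (hL : IsEnumeration τ X L) {x y : Ordinal.{0}} (hx : x ∈ X) (hy : y ∈ X)
    (h : rho (family τ L) x y ≤ k) :
    ∃ f ∈ L k, ∃ a < τ.m k, ∃ b < τ.m k, f a = x ∧ f b = y := by
  have hne : {k | ∃ F ∈ level (family τ L) k, x ∈ F ∧ y ∈ F}.Nonempty := by
    obtain ⟨l, -, f, hf, h⟩ := hL.cofinal {x, y} (by
      intro z hz
      rcases Finset.mem_insert.1 hz with rfl | hz
      · exact hx
      · rwa [Finset.mem_singleton.1 hz]) 0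
    exact ⟨l, _, hL.mem_level.2 ⟨f, hf, rfl⟩, mem_enumSet.2 (h x (by simp)),
      mem_enumSet.2 (h y (by simp))⟩
  obtain ⟨F, hF, hxF, hyF⟩ := Nat.sInf_mem hne
  obtain ⟨f, hf, rfl⟩ := hL.mem_level.1 hF
  obtain ⟨a, ha, rfl⟩ := mem_enumSet.1 hxF
  obtain ⟨b, hb, rfl⟩ := mem_enumSet.1 hyF
  obtain ⟨g, hg, hfg⟩ := hL.exists_superset hf h
  obtain ⟨p, hp, e⟩ := hfg a ha
  obtain ⟨q, hq, e'⟩ := hfg b hb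
  exact ⟨g, hg, p, hp, q, hq, e, e'⟩

theorem diam_le (hL : IsEnumeration τ X L)
    (hf : f ∈ L k) {A : Finset Ordinal.{0}} (hA : A ⊆ enumSet (τ.m k) f) :
    diam (family τ L) A ≤ k := by
  refine Finset.sup_le fun p hp => ?_
  rw [Finset.mem_product] at hp
  obtain ⟨a, ha, e⟩ := mem_enumSet.1 (hA hp.1)
  obtain ⟨b, hb, e'⟩ := mem_enumSet.1 (hA hp.2)
  rw [← e, ← e']
  exact hL.rho_le hf ha hb

/-- A set of level k containing both points would, by coherence, agree with piece j up to position
s', so the pieces i and j would share an element outside the root. -/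
theorem lt_rho (hL : IsEnumeration τ X L)
    (hh : h ∈ L (k + 1)) {i j s s' : ℕ} (hi : i < τ.n (k + 1)) (hj : j < τ.n (k + 1))
    (hij : i ≠ j) (hs : τ.r (k + 1) ≤ s) (hsm : s < τ.m k) (hs' : τ.r (k + 1) ≤ s')
    (hsm' : s' < τ.m k) :
    k < rho (family τ L) (h (τ.shift k i s)) (h (τ.shift k j s')) := by
  wlog hss : s ≤ s' generalizing i j s s'
  · have := this hj hi hij.symm hs' hsm' hs hsm (by omega)
    simpa only [rho, and_comm] using this
  by_contra hle
  obtain ⟨f, hf, a, ha, b, hb, e, e'⟩ := hL.exists_of_rho_le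
    (hL.mem _ h hh _ (shift_lt hsm hi)) (hL.mem _ h hh _ (shift_lt hsm' hj)) (not_lt.1 hle)
  obtain ⟨rfl, -⟩ := hL.coherent k f hf _ (hL.piece k h hh i hi) a ha s hsm e
  obtain ⟨rfl, h2⟩ := hL.coherent k f hf _ (hL.piece k h hh j hj) b hb s' hsm' e'
  have := hL.mono _ h hh |>.injOn (shift_lt hsm hi) (shift_lt hsm hj) (e.symm.trans (h2 a hss))
  rcases (shift_eq_shift hsm hsm this).2 with h | h
  · exact hij h
  · omega

end IsEnumeration

/-! ### Captured families -/

section Decomposition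

variable {τ : SchemeType} {X : Set Ordinal.{0}} {ℱ : Set (Finset Ordinal.{0})} {k : ℕ}
  {F R : Finset Ordinal.{0}} {P : ℕ → Finset Ordinal.{0}}

theorem IsDecomposition.root_subset (hd : IsDecomposition τ ℱ k F P R) {i : ℕ}
    (hi : i < τ.n (k + 1)) : R ⊆ P i := by
  have hn := τ.two_le_n k
  rcases eq_or_ne i 0 with rfl | h0
  · rw [← hd.inter_eq 0 hi 1 (by omega) (by omega)]; exact Finset.inter_subset_left
  · rw [← hd.inter_eq i hi 0 (by omega) h0]; exact Finset.inter_subset_left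

theorem IsDecomposition.card_union (hF : IsConstructionScheme τ X ℱ)
    (hd : IsDecomposition τ ℱ k F P R) {j : ℕ} (hj : j ≤ τ.n (k + 1)) :
    (R ∪ (Finset.range j).biUnion fun i => P i \ R).card =
      τ.r (k + 1) + j * (τ.m k - τ.r (k + 1)) := by
  induction j with
  | zero => simp [hd.card_root]
  | succ j ih =>
    have hjn : j < τ.n (k + 1) := hj
    rw [Finset.range_add_one, Finset.biUnion_insert, Finset.union_left_comm,
      Finset.card_union_of_disjoint, ih hjn.le, Finset.card_sdiff_of_subset (hd.root_subset hjn),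
      hF.card_eq k _ (hd.mem_level j hjn), hd.card_root]
    · ring
    · rw [Finset.disjoint_left]
      intro x hx hx'
      rw [Finset.mem_union, Finset.mem_biUnion] at hx'
      rcases hx' with hx' | ⟨i, hi, hx'⟩
      · exact (Finset.mem_sdiff.1 hx).2 hx'
      · exact lt_irrefl x ((hd.tails_below i j (Finset.mem_range.1 hi) hjn).2 x hx' x hx)

theorem IsDecomposition.card_lt_of_mem_root (hd : IsDecomposition τ ℱ k F P R) {x : Ordinal.{0}}
    (hx : x ∈ R) : (F.filter (· < x)).card < τ.r (k + 1) := by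
  rw [← hd.card_root]
  refine Finset.card_lt_card (Finset.ssubset_iff_of_subset ?_ |>.2 ⟨x, hx, by simp⟩)
  intro y hy
  rw [Finset.mem_filter, hd.union_eq, Finset.mem_biUnion] at hy
  obtain ⟨⟨i, hi, hyP⟩, hyx⟩ := hy
  by_contra hyR
  exact lt_asymm hyx ((hd.root_below i (Finset.mem_range.1 hi)).2 x hx y
    (Finset.mem_sdiff.2 ⟨hyP, hyR⟩))

/-- Counting predecessors in F recovers the index of the piece, whichever decomposition is used. -/
theorem IsDecomposition.card_of_mem_piece (hF : IsConstructionScheme τ X ℱ)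
    (hd : IsDecomposition τ ℱ k F P R) {j : ℕ} (hj : j < τ.n (k + 1)) {x : Ordinal.{0}}
    (hx : x ∈ P j) (hxR : x ∉ R) :
    τ.r (k + 1) + j * (τ.m k - τ.r (k + 1)) ≤ (F.filter (· < x)).card ∧
      (F.filter (· < x)).card < τ.r (k + 1) + (j + 1) * (τ.m k - τ.r (k + 1)) := by
  have hx' : x ∈ P j \ R := Finset.mem_sdiff.2 ⟨hx, hxR⟩
  constructor
  · rw [← hd.card_union hF hj.le]
    refine Finset.card_le_card fun y hy => ?_
    rw [Finset.mem_filter, hd.union_eq, Finset.mem_biUnion]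
    rw [Finset.mem_union, Finset.mem_biUnion] at hy
    rcases hy with hy | ⟨i, hi, hy⟩
    · exact ⟨⟨j, Finset.mem_range.2 hj, hd.root_subset hj hy⟩, (hd.root_below j hj).2 y hy x hx'⟩
    · rw [Finset.mem_range] at hi
      exact ⟨⟨i, Finset.mem_range.2 (hi.trans hj), (Finset.mem_sdiff.1 hy).1⟩,
        (hd.tails_below i j hi hj).2 y hy x hx'⟩
  · rw [← hd.card_union hF hj]
    refine Finset.card_lt_card (Finset.ssubset_iff_of_subset ?_ |>.2 ⟨x, ?_, by simp⟩)
    · intro y hy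
      rw [Finset.mem_filter, hd.union_eq, Finset.mem_biUnion] at hy
      obtain ⟨⟨i, hi, hyP⟩, hyx⟩ := hy
      rw [Finset.mem_range] at hi
      rw [Finset.mem_union, Finset.mem_biUnion]
      by_cases hyR : y ∈ R
      · exact Or.inl hyR
      · have hy' : y ∈ P i \ R := Finset.mem_sdiff.2 ⟨hyP, hyR⟩
        refine Or.inr ⟨i, Finset.mem_range.2 ?_, hy'⟩
        by_contra hij
        exact lt_asymm hyx ((hd.tails_below j i (by omega) hi).2 x hx' y hy')
    · exact Finset.mem_union_right _
        (Finset.mem_biUnion.2 ⟨j, Finset.mem_range.2 (Nat.lt_succ_self j), hx'⟩)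

end Decomposition

theorem exists_orderIso_image {α β : Type*} [LinearOrder α] [LinearOrder β] {A : Set α} {f g : α → β}
    (hf : StrictMonoOn f A) (hg : StrictMonoOn g A) :
    ∃ H : (f '' A) ≃o (g '' A), ∀ s (hs : s ∈ A), (H ⟨f s, Set.mem_image_of_mem f hs⟩ : β) = g s := by
  refine ⟨(hf.orderIso f A).symm.trans (hg.orderIso g A), fun s hs => ?_⟩
  have : (hf.orderIso f A).symm ⟨f s, Set.mem_image_of_mem f hs⟩ = ⟨s, hs⟩ := by
    rw [OrderIso.symm_apply_eq]; rfl
  rw [OrderIso.trans_apply, this]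
  rfl

/-- The copy, in the `i`-th piece of `h`, of the set of positions `t`. -/
noncomputable def copyOf (τ : SchemeType) (k : ℕ) (h : ℕ → Ordinal.{0})
    (t : Finset ℕ) (i : ℕ) : Finset Ordinal.{0} :=
  t.image fun s => h (τ.shift k i s)

namespace IsEnumeration

variable {τ : SchemeType} {X : Set Ordinal.{0}} {L : ℕ → Set (ℕ → Ordinal.{0})}
  {k : ℕ} {h : ℕ → Ordinal.{0}}

theorem card_filter_lt (hL : IsEnumeration τ X L) (hh : h ∈ L k) {p : ℕ} (hp : p < τ.m k) :
    ((enumSet (τ.m k) h).filter (· < h p)).card = p := by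
  have hM := hL.mono k h hh
  have : (enumSet (τ.m k) h).filter (· < h p) = (Finset.range p).image h := by
    ext x
    simp only [Finset.mem_filter, mem_enumSet, Finset.mem_image, Finset.mem_range]
    constructor
    · rintro ⟨⟨s, hs, rfl⟩, hlt⟩
      exact ⟨s, (hM.lt_iff_lt hs hp).1 hlt, rfl⟩
    · rintro ⟨s, hs, rfl⟩
      exact ⟨⟨s, hs.trans hp, rfl⟩, hM (hs.trans hp) hp hs⟩
  rw [this, Finset.card_image_of_injOn, Finset.card_range]
  exact hM.injOn.mono fun s hs => Set.mem_Iio.2 ((Finset.mem_range.1 hs).trans hp)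

/-- `XiEq` admits any F and any decomposition. Coherence fixes the position of a point outside the
root in every such F, and counting predecessors fixes its piece. -/
theorem xiEq_iff (hL : IsEnumeration τ X L)
    (hh : h ∈ L (k + 1)) {t : Finset ℕ} (ht : ∀ s ∈ t, s < τ.m k)
    (htr : ∃ s ∈ t, τ.r (k + 1) ≤ s) {i : ℕ} (hi : i < τ.n (k + 1)) (z : ℤ) :
    XiEq τ (family τ L) (copyOf τ k h t i) (k + 1) z ↔ z = i := by
  obtain ⟨s, hst, hs⟩ := htr
  have hsm := ht s hst
  have hr := τ.r_lt_m k
  have hx : h (τ.shift k i s) ∈ copyOf τ k h t i := Finset.mem_image_of_mem _ hst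
  have key : ∀ F ∈ level (family τ L) (k + 1), copyOf τ k h t i ⊆ F →
      (F.filter (· < h (τ.shift k i s))).card = s + i * (τ.m k - τ.r (k + 1)) := by
    intro F hF hsub
    obtain ⟨g, hg, rfl⟩ := hL.mem_level.1 hF
    obtain ⟨p, hp, e⟩ := mem_enumSet.1 (hsub hx)
    obtain ⟨rfl, -⟩ := hL.coherent _ g hg h hh p hp _ (shift_lt hsm hi) e
    rw [← e, hL.card_filter_lt hg hp, shift_of_le hs]
  constructor
  · rintro ⟨k', hk, F, hF, hsub, P, R, hd, hcase⟩
    obtain rfl : k = k' := by omega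
    have hcard := key F hF hsub
    have hxR : h (τ.shift k i s) ∉ R := by
      intro hxR
      have := hd.card_lt_of_mem_root hxR
      omega
    rcases hcase with ⟨h1, -⟩ | ⟨-, j, hj, h1, rfl⟩
    · exact absurd (h1 hx) hxR
    · have := hd.card_of_mem_piece hL.isConstructionScheme hj (h1 hx) hxR
      rw [hcard, add_mul] at this
      rcases lt_trichotomy i j with hij | rfl | hij
      · have := Nat.mul_le_mul_right (τ.m k - τ.r (k + 1)) hij
        rw [Nat.succ_mul] at this
        omega
      · rfl
      · have := Nat.mul_le_mul_right (τ.m k - τ.r (k + 1)) hij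
        rw [Nat.succ_mul] at this
        omega
  · rintro rfl
    have hlev : enumSet (τ.m (k + 1)) h ∈ level (family τ L) (k + 1) :=
      hL.mem_level.2 ⟨h, hh, rfl⟩
    have hsub : copyOf τ k h t i ⊆ enumSet (τ.m (k + 1)) h := by
      intro x hx
      obtain ⟨s, hs, rfl⟩ := Finset.mem_image.1 hx
      exact mem_enumSet.2 ⟨_, shift_lt (ht s hs) hi, rfl⟩
    refine ⟨k, rfl, _, hlev, hsub, _, _, hL.isDecomposition hh, Or.inr ⟨fun hR => ?_, i, hi, ?_, rfl⟩⟩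
    · have := (hL.isDecomposition hh).card_lt_of_mem_root (hR hx)
      rw [key _ hlev hsub] at this
      omega
    · intro x hx
      obtain ⟨s, hs, rfl⟩ := Finset.mem_image.1 hx
      exact mem_enumSet.2 ⟨s, ht s hs, rfl⟩

/-- A set of level k through a point of the piece agrees with the piece below that point, so only
the largest position M counts. -/
theorem closure_copyOf (hL : IsEnumeration τ X L)
    (hh : h ∈ L (k + 1)) {t : Finset ℕ} {M : ℕ} (hM : M ∈ t)
    (htM : ∀ s ∈ t, s ≤ M) (hMm : M < τ.m k) {i : ℕ} (hi : i < τ.n (k + 1)) :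
    closure X (family τ L) (copyOf τ k h t i) k = (fun s => h (τ.shift k i s)) '' Set.Iic M := by
  have hp := hL.piece k h hh i hi
  have hmono := hL.mono k _ hp
  ext x
  constructor
  · rintro ⟨hxX, y, hy, hxy, hrho⟩
    obtain ⟨s, hs, rfl⟩ := Finset.mem_image.1 hy
    have hsm := (htM s hs).trans_lt hMm
    obtain ⟨f, hf, a, ha, b, hb, rfl, e⟩ :=
      hL.exists_of_rho_le hxX (hL.mem _ h hh _ (shift_lt hsm hi)) hrho
    obtain ⟨rfl, h2⟩ := hL.coherent k f hf _ hp b hb s hsm e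
    rw [← e, (hL.mono k f hf).le_iff_le ha hb] at hxy
    exact ⟨a, hxy.trans (htM b hs), (h2 a hxy).symm⟩
  · rintro ⟨s, hs, rfl⟩
    have hsm : s < τ.m k := lt_of_le_of_lt hs hMm
    exact ⟨hL.mem _ h hh _ (shift_lt hsm hi), _, Finset.mem_image_of_mem _ hM,
      hmono.monotoneOn hsm hMm hs, hL.rho_le hp hsm hMm⟩

/-- The position outside the root separates the copies, yields Ξ = i and forces diameter k + 1. The
strong isomorphism matches equal positions in two pieces. -/
theorem isFullyCaptured (hL : IsEnumeration τ X L)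
    (hh : h ∈ L (k + 1)) {t : Finset ℕ} (ht : ∀ s ∈ t, s < τ.m k)
    (htr : ∃ s ∈ t, τ.r (k + 1) ≤ s) :
    IsFullyCaptured τ X (family τ L)
      ((Finset.range (τ.n (k + 1))).image (copyOf τ k h t)) (k + 1) := by
  obtain ⟨s₀, hst, hs₀⟩ := id htr
  have hsm := ht s₀ hst
  have hn := τ.two_le_n k
  have hx : ∀ i, h (τ.shift k i s₀) ∈ copyOf τ k h t i := fun i => Finset.mem_image_of_mem _ hst
  have hinj : Set.InjOn (copyOf τ k h t) (Finset.range (τ.n (k + 1))) := by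
    intro i hi j hj e
    have h1 := (hL.xiEq_iff hh ht htr (Finset.mem_range.1 hi) i).2 rfl
    rw [e, hL.xiEq_iff hh ht htr (Finset.mem_range.1 hj)] at h1
    exact_mod_cast h1
  have hcard : ((Finset.range (τ.n (k + 1))).image (copyOf τ k h t)).card = τ.n (k + 1) := by
    rw [Finset.card_image_of_injOn hinj, Finset.card_range]
  have hsub : ∀ i < τ.n (k + 1), copyOf τ k h t i ⊆ enumSet (τ.m (k + 1)) h := by
    intro i hi x hx
    obtain ⟨s, hs, rfl⟩ := Finset.mem_image.1 hx
    exact mem_enumSet.2 ⟨_, shift_lt (ht s hs) hi, rfl⟩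
  have hdiam : ∀ A ⊆ enumSet (τ.m (k + 1)) h, ∀ i < τ.n (k + 1), ∀ j < τ.n (k + 1), i ≠ j →
      copyOf τ k h t i ⊆ A → copyOf τ k h t j ⊆ A → diam (family τ L) A = k + 1 := by
    intro A hA i hi j hj hij hiA hjA
    refine le_antisymm (hL.diam_le hh hA) ((Nat.succ_le_of_lt
      (hL.lt_rho hh hi hj hij hs₀ hsm hs₀ hsm)).trans ?_)
    exact Finset.le_sup (f := fun p : Ordinal.{0} × Ordinal.{0} => rho (family τ L) p.1 p.2)
      (Finset.mk_mem_product (hiA (hx i)) (hjA (hx j)))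
  have hdlt : ∀ i < τ.n (k + 1), diam (family τ L) (copyOf τ k h t i) < k + 1 := by
    refine fun i hi => Nat.lt_succ_of_le (hL.diam_le (hL.piece k h hh i hi) fun x hx => ?_)
    obtain ⟨s, hs, rfl⟩ := Finset.mem_image.1 hx
    exact mem_enumSet.2 ⟨s, ht s hs, rfl⟩
  refine ⟨⟨by rw [hcard]; exact hn, hcard.le, ?_, ?_, ?_, ?_⟩, hcard⟩
  · refine hdiam _ (fun x hx => ?_) 0 (by omega) 1 (by omega) (by omega) ?_ ?_
    · obtain ⟨D, hD, hxD⟩ := Finset.mem_biUnion.1 hx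
      obtain ⟨i, hi, rfl⟩ := Finset.mem_image.1 hD
      exact hsub i (Finset.mem_range.1 hi) hxD
    · exact Finset.subset_biUnion_of_mem id
        (Finset.mem_image_of_mem _ (Finset.mem_range.2 (by omega)))
    · exact Finset.subset_biUnion_of_mem id
        (Finset.mem_image_of_mem _ (Finset.mem_range.2 (by omega)))
  · intro D hD
    obtain ⟨i, hi, rfl⟩ := Finset.mem_image.1 hD
    exact hdlt i (Finset.mem_range.1 hi)
  · rw [hcard]
    ext z
    simp only [Set.mem_ofPred_eq, Finset.mem_image, Finset.mem_range]
    constructor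
    · rintro ⟨_, ⟨i, hi, rfl⟩, hz⟩
      rw [hL.xiEq_iff hh ht htr hi] at hz
      omega
    · rintro ⟨h0, h1⟩
      obtain ⟨i, rfl⟩ := Int.eq_ofNat_of_zero_le h0
      have hi : i < τ.n (k + 1) := by exact_mod_cast h1
      exact ⟨_, ⟨i, hi, rfl⟩, (hL.xiEq_iff hh ht htr hi _).2 rfl⟩
  · intro D hD D' hD' hne
    obtain ⟨i, hi, rfl⟩ := Finset.mem_image.1 hD
    obtain ⟨j, hj, rfl⟩ := Finset.mem_image.1 hD'
    rw [Finset.mem_range] at hi hj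
    have hij : i ≠ j := fun e => hne (by rw [e])
    have hd := hdiam _ (Finset.union_subset (hsub i hi) (hsub j hj)) i hi j hj hij
      Finset.subset_union_left Finset.subset_union_right
    unfold StronglyIsomorphic
    rw [hd, Nat.add_sub_cancel]
    refine ⟨hdlt i hi, hdlt j hj, ?_⟩
    have hMt := t.max'_mem ⟨s₀, hst⟩
    have htM : ∀ s ∈ t, s ≤ t.max' ⟨s₀, hst⟩ := fun s hs => t.le_max' s hs
    set M := t.max' ⟨s₀, hst⟩
    have hIic : Set.Iic M ⊆ Set.Iio (τ.m k) := fun s hs => lt_of_le_of_lt hs (ht M hMt)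
    rw [hL.closure_copyOf hh hMt htM (ht M hMt) hi, hL.closure_copyOf hh hMt htM (ht M hMt) hj]
    obtain ⟨H, hH⟩ := exists_orderIso_image ((hL.mono k _ (hL.piece k h hh i hi)).mono hIic)
      ((hL.mono k _ (hL.piece k h hh j hj)).mono hIic)
    refine ⟨H, ?_⟩
    have hinjP := (hL.mono k _ (hL.piece k h hh i hi)).injOn
    ext x
    constructor
    · rintro ⟨⟨_, s, hs, rfl⟩, hy, rfl⟩
      obtain ⟨s', hs', e⟩ := Finset.mem_image.1 hy
      obtain rfl := hinjP (ht s' hs') (hIic hs) e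
      exact Finset.mem_coe.2 (Finset.mem_image.2 ⟨s', hs', (hH s' hs).symm⟩)
    · intro hx
      obtain ⟨s, hs, rfl⟩ := Finset.mem_image.1 (Finset.mem_coe.1 hx)
      have hmem : h (τ.shift k i s) ∈ copyOf τ k h t i := Finset.mem_image_of_mem _ hs
      exact ⟨⟨_, s, htM s hs, rfl⟩, hmem, hH s (htM s hs)⟩

end IsEnumeration

/-! ### Closure points -/

theorem countable_finset_subset {A : Set Ordinal.{0}} (hA : A.Countable) :
    {B : Finset Ordinal.{0} | (B : Set Ordinal.{0}) ⊆ A}.Countable := by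
  classical
  have : Countable A := hA.to_subtype
  refine (Set.countable_range fun B : Finset A => B.map (Function.Embedding.subtype _)).mono ?_
  intro B hB
  exact ⟨B.subtype (· ∈ A), Finset.subtype_map_of_mem fun x hx => hB hx⟩

theorem exists_closure_bound {G : Finset Ordinal.{0} → Ordinal.{0}}
    (hG : ∀ A : Finset Ordinal.{0}, (A : Set Ordinal.{0}) ⊆ Set.Iio ω₁ → G A < ω₁)
    {β : Ordinal.{0}} (hβ : β < ω₁) :
    ∃ β' < ω₁, β ≤ β' ∧ ∀ A : Finset Ordinal.{0}, (A : Set Ordinal.{0}) ⊆ Set.Iio β → G A < β' := by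
  have : Countable {B : Finset Ordinal.{0} | (B : Set Ordinal.{0}) ⊆ Set.Iio β} :=
    (countable_finset_subset (countable_Iio_of_lt hβ)).to_subtype
  have hsup : ⨆ B : {B : Finset Ordinal.{0} | (B : Set Ordinal.{0}) ⊆ Set.Iio β}, G B.1 < ω₁ :=
    iSup_lt_omega_one fun B => hG B.1 (B.2.trans (Set.Iio_subset_Iio hβ.le))
  refine ⟨max β (Order.succ (⨆ B : {B : Finset Ordinal.{0} | (B : Set Ordinal.{0}) ⊆ Set.Iio β},
    G B.1)), max_lt hβ ((Cardinal.isSuccLimit_omega 1).succ_lt hsup), le_max_left _ _, fun A hA => ?_⟩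
  refine lt_of_lt_of_le (Order.lt_succ_of_le ?_) (le_max_right _ _)
  exact Ordinal.le_iSup (fun B : {B : Finset Ordinal.{0} | (B : Set Ordinal.{0}) ⊆ Set.Iio β} =>
    G B.1) ⟨A, hA⟩

/-- A finite set below a supremum is below one member of the set, which gives closure; iterating
`exists_closure_bound` ω times gives unboundedness. -/
theorem isClub_closurePoints {G : Finset Ordinal.{0} → Ordinal.{0}}
    (hG : ∀ A : Finset Ordinal.{0}, (A : Set Ordinal.{0}) ⊆ Set.Iio ω₁ → G A < ω₁) :
    IsClub {α : Set.Iio (ω₁ : Ordinal.{0}) | ∀ A : Finset Ordinal.{0},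
      (A : Set Ordinal.{0}) ⊆ Set.Iio (α : Ordinal.{0}) → G A < α} := by
  constructor
  · intro d hd hne _ a ha A hA
    obtain ⟨β, hβ, hAβ⟩ : ∃ β ∈ d, (A : Set Ordinal.{0}) ⊆ Set.Iio (β : Ordinal.{0}) := by
      induction A using Finset.induction_on with
      | empty => obtain ⟨β, hβ⟩ := hne; exact ⟨β, hβ, by simp⟩
      | insert x A _ ih =>
        rw [Finset.coe_insert, Set.insert_subset_iff] at hA
        obtain ⟨β, hβ, hAβ⟩ := ih hA.2
        have hxa : x < a := hA.1
        obtain ⟨γ, hγ, hxγ⟩ := (lt_isLUB_iff ha (b := ⟨x, hxa.trans a.2⟩)).1 hxa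
        have hxγ' : x < (γ : Ordinal.{0}) := hxγ
        rw [Finset.coe_insert]
        rcases le_total β γ with h | h
        · exact ⟨γ, hγ, Set.insert_subset_iff.2 ⟨hxγ', hAβ.trans (Set.Iio_subset_Iio h)⟩⟩
        · have h' : (γ : Ordinal.{0}) ≤ β := h
          exact ⟨β, hβ, Set.insert_subset_iff.2 ⟨hxγ'.trans_le h', hAβ⟩⟩
    have hle : (β : Ordinal.{0}) ≤ a := ha.1 hβ
    exact (hd hβ A hAβ).trans_le hle
  · rintro ⟨α, hα⟩
    choose! g hg hle hcl using fun (β : Ordinal.{0}) (hβ : β < ω₁) => exists_closure_bound hG hβ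
    let q : ℕ → Ordinal.{0} := fun n => g^[n] α
    have hq : ∀ n, q (n + 1) = g (q n) := fun n => Function.iterate_succ_apply' g n α
    have hqlt : ∀ n, q n < ω₁ := by
      intro n
      induction n with
      | zero => exact hα
      | succ n ih => rw [hq]; exact hg _ ih
    have hmono : Monotone q := monotone_nat_of_le_succ fun n => by rw [hq]; exact hle _ (hqlt n)
    refine ⟨⟨⨆ n, q n, iSup_lt_omega_one hqlt⟩, fun A hA => ?_, Ordinal.le_iSup q 0⟩
    obtain ⟨n, hn⟩ : ∃ n, (A : Set Ordinal.{0}) ⊆ Set.Iio (q n) := by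
      induction A using Finset.induction_on with
      | empty => exact ⟨0, by simp⟩
      | insert x A _ ih =>
        rw [Finset.coe_insert, Set.insert_subset_iff] at hA
        obtain ⟨n, hn⟩ := ih hA.2
        obtain ⟨l, hl⟩ := Ordinal.lt_iSup_iff.1 hA.1
        rw [Finset.coe_insert]
        exact ⟨max n l, Set.insert_subset_iff.2 ⟨hl.trans_le (hmono (le_max_right _ _)),
          hn.trans (Set.Iio_subset_Iio (hmono (le_max_left _ _)))⟩⟩
    refine (hcl _ (hqlt n) A hn).trans_le ?_
    rw [← hq]
    exact Ordinal.le_iSup q (n + 1)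

/-- ◇ guesses sets of ordinals; this coding lets it guess families of finite sets. -/
theorem exists_code : ∃ c : Finset Ordinal.{0} → Ordinal.{0}, (∀ A, c A < ω₁) ∧
    Set.InjOn c {A | (A : Set Ordinal.{0}) ⊆ Set.Iio ω₁} := by
  classical
  have : Infinite (Set.Iio (ω₁ : Ordinal.{0})) := by
    refine Infinite.of_injective (fun n : ℕ => (⟨n, (natCast_lt_omega0 n).trans
      omega0_lt_omega_one⟩ : Set.Iio (ω₁ : Ordinal.{0}))) fun a b h => ?_
    exact Nat.cast_injective (Subtype.ext_iff.1 h)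
  obtain ⟨e⟩ := Cardinal.eq.1 (Cardinal.mk_finset_of_infinite (Set.Iio (ω₁ : Ordinal.{0})))
  refine ⟨fun A => e (A.subtype (· ∈ Set.Iio ω₁)), fun A => (e _).2, fun A hA B hB h => ?_⟩
  have h' := e.injective (Subtype.ext h)
  rw [← Finset.subtype_map_of_mem (p := (· ∈ Set.Iio ω₁)) (s := A) fun x hx => hA hx, h',
    Finset.subtype_map_of_mem fun x hx => hB hx]

/-! ### The scheme is fully capturing -/

section Capturing

variable {τ : SchemeType} {Pf : ℕ → Set ℕ} {S : Ordinal.{0} → Set (Finset Ordinal.{0})}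
  {E : Ordinal.{0} → ℕ → ℕ → Ordinal.{0}}

theorem omega_mul_omega_one : ω * (ω₁ : Ordinal.{0}) = ω₁ := by
  refine le_antisymm (le_of_forall_lt fun x hx => ?_) (le_mul_right _ omega0_pos)
  obtain ⟨η, hη, h⟩ := exists_lt_mul_succ hx
  exact h.trans (omega_mul_lt_omega_one ((Cardinal.isSuccLimit_omega 1).succ_lt hη))

theorem isEnumeration_lev (hE : ∀ ξ < ω₁, IsChain τ E ξ) :
    IsEnumeration τ (Set.Iio ω₁) (Lev τ E ω₁) where
  mem k f hf s hs := by
    have := Lev.lt hE k f hf s hs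
    rwa [omega_mul_omega_one] at this
  mono := Lev.strictMonoOn hE
  piece := Lev.piece
  coherent := Lev.coherent hE
  cofinal A hA N := by
    obtain ⟨η, hη, h⟩ := exists_forall_lt_mul_succ (ξ := ω₁) (omega_pos 1) A
      fun x hx => by rw [omega_mul_omega_one]; exact hA hx
    obtain ⟨k, hk, h⟩ := (hE η hη).exists_forall_mem A h N
    exact ⟨k, hk, _, Lev.mem hη k, h k le_rfl⟩

/-- `E ζ (k + 1)` continues `E ξ k` and has its first `j + 1` copies of `t` in `𝒮`. -/
structure Candidate (τ : SchemeType) (S : Ordinal.{0} → Set (Finset Ordinal.{0}))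
    (E : Ordinal.{0} → ℕ → ℕ → Ordinal.{0}) (𝒮 : Set (Finset Ordinal.{0})) (ξ ζ : Ordinal.{0})
    (k : ℕ) (t : Finset ℕ) (j : ℕ) : Prop where
  lt : ξ < ω₁
  lt' : ζ < ω₁
  mem_lt : ∀ s ∈ t, s < τ.m k
  exists_le : ∃ s ∈ t, τ.r (k + 1) ≤ s
  act : Act τ (Lev τ E ξ) (S ξ) (ω * ξ) (E ξ) k t j
  root : ∀ s < τ.r (k + 1), E ζ (k + 1) s = E ξ k s
  mem : ∀ i ≤ j, copyOf τ k (E ζ (k + 1)) t i ∈ 𝒮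

/-- The last copy is a member of 𝒮 not below ω·ξ, placed by `E ζ` as piece j; the copies before it
are those chosen by `E ξ` from the guess. -/
theorem exists_candidate (hE : ∀ ξ < ω₁, Stage τ Pf S E ξ) {𝒮 : Set (Finset Ordinal.{0})}
    (h𝒮 : 𝒮 ⊆ FIN (Set.Iio ω₁)) (hunc : ¬ 𝒮.Countable) {ξ : Ordinal.{0}} (hξ : 0 < ξ)
    (hξ' : ξ < ω₁) (hS : S ξ ⊆ 𝒮) (p N : ℕ) :
    ∃ ζ k t j, N ≤ k ∧ k + 1 ∈ Pf p ∧ Candidate τ S E 𝒮 ξ ζ k t j := by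
  have hE' : ∀ ξ < ω₁, IsChain τ E ξ := fun ξ hξ => (hE ξ hξ).toIsChain
  obtain ⟨A, hA, x, hxA, hx⟩ : ∃ A ∈ 𝒮, ∃ x ∈ A, ω * ξ ≤ x := by
    by_contra! hcon
    refine hunc ((countable_finset_subset
      (countable_Iio_of_lt (omega_mul_lt_omega_one hξ'))).mono fun A hA x hx => hcon A hA x hx)
  obtain ⟨ζ, hζ, hζA⟩ := exists_forall_lt_mul_succ (ξ := ω₁) (omega_pos 1) (insert (ω * ξ) A) (by
    intro y hy
    rw [omega_mul_omega_one]
    rcases Finset.mem_insert.1 hy with rfl | hy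
    · exact omega_mul_lt_omega_one hξ'
    · exact (h𝒮 hA).2 hy)
  have hξζ : ξ ≤ ζ := by
    have := (mul_lt_mul_iff_right₀ omega0_pos).1 (hζA _ (Finset.mem_insert_self _ _))
    exact Order.lt_add_one_iff.1 this
  obtain ⟨k₀, -, hk₀⟩ := (hE' ζ hζ).exists_forall_mem _ hζA 0
  let t₀ := (Finset.range (τ.m k₀)).filter fun s => E ζ k₀ s ∈ A
  have ht₀ : t₀.image (E ζ k₀) = A := by
    ext y
    simp only [t₀, Finset.mem_image, Finset.mem_filter, Finset.mem_range]
    constructor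
    · rintro ⟨s, ⟨-, hs⟩, rfl⟩; exact hs
    · intro hy
      obtain ⟨s, hs, rfl⟩ := hk₀ k₀ le_rfl y (Finset.mem_insert_of_mem hy)
      exact ⟨s, ⟨hs, hy⟩, rfl⟩
  obtain ⟨k, hk₀k, hNk, hkP, j, t, ht, hact, hpc, himg⟩ := (hE ζ hζ).act ξ hξ hξζ k₀ t₀
    (fun s hs => Finset.mem_range.1 (Finset.mem_filter.1 hs).1) p N
  rw [ht₀] at himg
  have hr := τ.r_lt_m k
  have hζk : E ζ k (τ.r (k + 1)) = ω * ξ := by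
    obtain ⟨b, hb, e⟩ := hk₀ k hk₀k _ (Finset.mem_insert_self _ _)
    obtain ⟨rfl, -⟩ := Lev.coherent hE' k _ (Lev.mem hζ k) _ (Lev.mem hξ' k) b hb _ hr
      (e.trans hact.base.symm)
    exact e
  -- `E ζ (k + 1)` and `E ξ (k + 1)` both contain ω·ξ in piece j just after the root, so coherence
  -- identifies all the preceding pieces.
  have hagree : ∀ s ≤ τ.shift k j (τ.r (k + 1)), E ζ (k + 1) s = E ξ (k + 1) s :=
    (Lev.coherent hE' (k + 1) _ (Lev.mem hζ _) _ (Lev.mem hξ' _) _ (shift_lt hr hact.lt) _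
      (shift_lt hr hact.lt) (by rw [← hpc _ hr, ← hact.piece _ hr, hζk, hact.base])).2
  rw [shift_of_le le_rfl] at hagree
  refine ⟨ζ, k, t, j, hNk, hkP, hξ', hζ, ht, ?_, hact, fun s hs => ?_, fun i hi => ?_⟩
  · rw [← himg] at hxA
    obtain ⟨s, hs, rfl⟩ := Finset.mem_image.1 hxA
    refine ⟨s, hs, ?_⟩
    rw [← hζk] at hx
    exact ((Lev.strictMonoOn hE' k _ (Lev.mem hζ k)).le_iff_le hr (ht s hs)).1 hx
  · rw [hagree s (by omega), hact.piece s (hs.trans hr), shift_of_lt hs]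
  · rcases hi.eq_or_lt with rfl | hi
    · have : copyOf τ k (E ζ (k + 1)) t i = A := by
        rw [← himg]
        exact Finset.image_congr fun s hs => (hpc s (ht s hs)).symm
      rwa [this]
    · have : copyOf τ k (E ζ (k + 1)) t i = t.image fun s => E ξ (k + 1) (τ.shift k i s) :=
        Finset.image_congr fun s hs => hagree _ (shift_lt_of_lt (ht s hs) hi).le
      rw [this]
      exact hS (hact.mem i hi)

/-- By maximality, a candidate with an earlier twin captures fully. -/
theorem Candidate.succ_eq (hE : ∀ ξ < ω₁, Stage τ Pf S E ξ) {𝒮 : Set (Finset Ordinal.{0})}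
    {ξ ζ ξ₀ ζ₀ : Ordinal.{0}} {k : ℕ} {t : Finset ℕ} {j : ℕ} (h : Candidate τ S E 𝒮 ξ ζ k t j)
    (hS : ∀ A : Finset Ordinal.{0}, (A : Set Ordinal.{0}) ⊆ Set.Iio (ω * ξ) → A ∈ 𝒮 → A ∈ S ξ)
    (h₀ : Candidate τ S E 𝒮 ξ₀ ζ₀ k t j) (hlt : ζ₀ < ξ)
    (hroot : enumSet (τ.r (k + 1)) (E ξ₀ k) = enumSet (τ.r (k + 1)) (E ξ k)) :
    j + 1 = τ.n (k + 1) := by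
  have hE' : ∀ ξ < ω₁, IsChain τ E ξ := fun ξ hξ => (hE ξ hξ).toIsChain
  have hr := τ.r_lt_m k
  have heq : ∀ s < τ.r (k + 1), E ξ₀ k s = E ξ k s := by
    intro s hs
    have hmem : E ξ₀ k s ∈ enumSet (τ.r (k + 1)) (E ξ k) := by
      rw [← hroot]; exact mem_enumSet.2 ⟨s, hs, rfl⟩
    obtain ⟨b, hb, e⟩ := mem_enumSet.1 hmem
    exact (Lev.coherent hE' k _ (Lev.mem h₀.lt k) _ (Lev.mem h.lt k) s (hs.trans hr) b
      (hb.trans hr) e.symm).2 s le_rfl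
  have hjn := h.act.lt
  by_contra hne
  -- The twin `E ζ₀ (k + 1)` belongs to the scheme below ω·ξ and its j + 1 copies belong to the
  -- guess, so it competes with the choice of j.
  have := h.act.max (j + 1) (by omega) (E ζ₀ (k + 1)) (Lev.mem hlt _)
    (fun s hs => (h₀.root s hs).trans (heq s hs)) fun i hi => ?_
  · omega
  · refine hS _ (fun x hx => ?_) (h₀.mem i (by omega))
    obtain ⟨s, hs, rfl⟩ := Finset.mem_image.1 (Finset.mem_coe.1 hx)
    exact Lev.lt (fun η hη => hE' η (hη.trans h.lt)) _ _ (Lev.mem hlt _) _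
      (shift_lt (h₀.mem_lt s hs) (by omega))

theorem isFullyCapturing_lev {D : Ordinal.{0} → Set Ordinal.{0}} (hD : IsDiamondSequence D)
    {c : Finset Ordinal.{0} → Ordinal.{0}} (hc : ∀ A, c A < ω₁)
    (hcinj : Set.InjOn c {A | (A : Set Ordinal.{0}) ⊆ Set.Iio ω₁})
    (hS : ∀ ξ, S ξ = {A : Finset Ordinal.{0} | (A : Set Ordinal.{0}) ⊆ Set.Iio (ω * ξ) ∧ c A ∈ D (ω * ξ)})
    (hE : ∀ ξ < ω₁, Stage τ Pf S E ξ) :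
    IsFullyCapturing τ (Set.Iio ω₁) (family τ (Lev τ E ω₁)) (Set.range Pf) := by
  have hE' : ∀ ξ < ω₁, IsChain τ E ξ := fun ξ hξ => (hE ξ hξ).toIsChain
  rintro 𝒮 h𝒮 hunc _ ⟨p, rfl⟩
  refine Set.infinite_of_forall_exists_gt fun N => ?_
  -- For each root R and each of the countably many data (k, t, j), one candidate is fixed
  -- independently of ξ, and β bounds it.
  have hbound : ∀ (R : Finset Ordinal.{0}) (d : ℕ × Finset ℕ × ℕ), ∃ β < ω₁,
      ∀ ξ ζ, Candidate τ S E 𝒮 ξ ζ d.1 d.2.1 d.2.2 → enumSet (τ.r (d.1 + 1)) (E ξ d.1) = R →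
        ∃ ξ₀ ζ₀, Candidate τ S E 𝒮 ξ₀ ζ₀ d.1 d.2.1 d.2.2 ∧
          enumSet (τ.r (d.1 + 1)) (E ξ₀ d.1) = R ∧ ω * (ζ₀ + 1) ≤ β := by
    intro R d
    by_cases h : ∃ ξ ζ, Candidate τ S E 𝒮 ξ ζ d.1 d.2.1 d.2.2 ∧
        enumSet (τ.r (d.1 + 1)) (E ξ d.1) = R
    · obtain ⟨ξ, ζ, h1, h2⟩ := h
      exact ⟨ω * (ζ + 1), omega_mul_lt_omega_one ((Cardinal.isSuccLimit_omega 1).succ_lt h1.lt'),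
        fun _ _ _ _ => ⟨ξ, ζ, h1, h2, le_rfl⟩⟩
    · exact ⟨0, omega_pos 1, fun ξ ζ h1 h2 => absurd ⟨ξ, ζ, h1, h2⟩ h⟩
  choose β hβ hβ' using hbound
  -- Closure under c makes the guess of codes decide membership in 𝒮 below α; closure under the
  -- suprema of β brings the fixed candidates with root below α under α.
  obtain ⟨α, ⟨hlim, hguess⟩, hclosed⟩ := hD.2 (c '' 𝒮) (by rintro _ ⟨A, -, rfl⟩; exact hc A)
    (isClub_closurePoints (G := fun A => max (c A) (⨆ d, β A d))
      fun A _ => max_lt (hc A) (iSup_lt_omega_one (hβ A)))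
  obtain ⟨ξ, hξα⟩ : ω ∣ (α : Ordinal.{0}) := isSuccPrelimit_iff_omega0_dvd.1 hlim.isSuccPrelimit
  have hα : (α : Ordinal.{0}) < ω₁ := α.2
  have hξ0 : 0 < ξ := by
    refine pos_iff_ne_zero.2 ?_
    rintro rfl
    exact hlim.ne_bot (by rw [hξα, mul_zero]; rfl)
  have hξ1 : ξ < ω₁ := (le_mul_right ξ omega0_pos).trans_lt (hξα ▸ hα)
  have hguess' : ∀ A : Finset Ordinal.{0}, (A : Set Ordinal.{0}) ⊆ Set.Iio (ω * ξ) →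
      (A ∈ S ξ ↔ A ∈ 𝒮) := by
    intro A hA
    have hcA : c A < α := (le_max_left _ _).trans_lt (hclosed A (by rwa [hξα]))
    rw [hS]
    constructor
    · rintro ⟨-, hAD⟩
      rw [← hξα, ← hguess] at hAD
      obtain ⟨B, hB, e⟩ := hAD.1
      rwa [← hcinj (h𝒮 hB).2 (hA.trans (Set.Iio_subset_Iio (hξα ▸ hα).le)) e]
    · intro hA𝒮
      refine ⟨hA, ?_⟩
      rw [← hξα, ← hguess]
      exact ⟨⟨A, hA𝒮, rfl⟩, hcA⟩
  obtain ⟨ζ, k, t, j, hNk, hkP, hcand⟩ := exists_candidate hE h𝒮 hunc hξ0 hξ1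
    (fun A hA => (hguess' A (by rw [hS] at hA; exact hA.1)).1 hA) p N
  have hr := τ.r_lt_m k
  have hRα : (enumSet (τ.r (k + 1)) (E ξ k) : Set Ordinal.{0}) ⊆ Set.Iio (α : Ordinal.{0}) := by
    intro x hx
    obtain ⟨s, hs, rfl⟩ := mem_enumSet.1 (Finset.mem_coe.1 hx)
    rw [Set.mem_Iio, hξα, ← hcand.act.base]
    exact Lev.strictMonoOn hE' k _ (Lev.mem hξ1 k) (hs.trans hr) hr hs
  obtain ⟨ξ₀, ζ₀, hcand₀, hroot, hle⟩ := hβ' (enumSet (τ.r (k + 1)) (E ξ k)) (k, t, j) ξ ζ hcand rfl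
  have hlt : ζ₀ < ξ := by
    have h1 : ω * (ζ₀ + 1) < ω * ξ := by
      rw [← hξα]
      refine hle.trans_lt (lt_of_le_of_lt ?_ (hclosed _ hRα))
      exact (Ordinal.le_iSup (β _) (k, t, j)).trans (le_max_right _ _)
    exact (lt_add_one ζ₀).trans ((mul_lt_mul_iff_right₀ omega0_pos).1 h1)
  have hj := hcand.succ_eq hE (fun A hA hA' => (hguess' A hA).2 hA') hcand₀ hlt hroot
  refine ⟨k + 1, ⟨hkP, _, ?_, (isEnumeration_lev hE').isFullyCaptured (Lev.mem hcand.lt' (k + 1))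
    hcand.mem_lt hcand.exists_le⟩, by omega⟩
  intro A hA
  obtain ⟨i, hi, rfl⟩ := Finset.mem_image.1 (Finset.mem_coe.1 hA)
  exact hcand.mem i (by have := Finset.mem_range.1 hi; omega)

end Capturing

/-- Blocks are nonempty and disjoint subsets of ω, hence countably many; indexing them by naturals
makes the requirements countable. -/
theorem exists_range_eq_of_isPartition {𝒬 : Set (Set ℕ)} (h : Setoid.IsPartition 𝒬) :
    ∃ Pf : ℕ → Set ℕ, 𝒬 = Set.range Pf := by
  obtain ⟨P, ⟨hP, -⟩, -⟩ := h.2 0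
  refine Set.Countable.exists_eq_range ?_ ⟨P, hP⟩
  choose! f hf using fun n => (h.2 n).exists
  refine (Set.countable_range f).mono fun Q hQ => ?_
  obtain ⟨n, hn⟩ := Setoid.nonempty_of_mem_partition h hQ
  exact ⟨n, (h.2 n).unique (hf n) ⟨hQ, hn⟩⟩

end ConstructionScheme

theorem mainTheorem1 (hDiamond : ConstructionScheme.DiamondPrinciple)
    (τ : ConstructionScheme.SchemeType) (hτ : τ.IsGood)
    (𝒬 : Set (Set ℕ)) (h𝒬 : Setoid.IsPartition 𝒬) (hcomp : τ.Compatible 𝒬) :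
    ∃ ℱ : Set (Finset Ordinal.{0}),
      ConstructionScheme.IsConstructionScheme τ (Set.Iio (Ordinal.omega 1)) ℱ ∧
      ConstructionScheme.IsFullyCapturing τ (Set.Iio (Ordinal.omega 1)) ℱ 𝒬 := by
  obtain ⟨D, hD⟩ := hDiamond
  obtain ⟨c, hc, hcinj⟩ := ConstructionScheme.exists_code
  obtain ⟨Pf, rfl⟩ := ConstructionScheme.exists_range_eq_of_isPartition h𝒬
  obtain ⟨E, hE⟩ := ConstructionScheme.exists_chains τ Pf (fun p => hcomp _ ⟨p, rfl⟩)
    fun ξ => {A : Finset Ordinal.{0} | (A : Set Ordinal.{0}) ⊆ Set.Iio (ω * ξ) ∧ c A ∈ D (ω * ξ)}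
  exact ⟨_, (ConstructionScheme.isEnumeration_lev fun ξ hξ =>
      (hE ξ hξ).toIsChain).isConstructionScheme,
    ConstructionScheme.isFullyCapturing_lev hD hc hcinj (fun _ => rfl) hE⟩
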